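/- Let $0<\theta<\pi$. For $E,E'>0$ let $\theta(E',E)\in(0,\pi)$ be the argument of $E'E^{-1}+e^{i\theta}$, that is, $\theta(E',E)=\tan^{-1}\frac{\sin\theta}{E'E^{-1}+\cos\theta}$ with the branch of $\tan^{-1}$ taking values in $(0,\pi)$. Let $Q=(Q_k)_{k\ge1}$ be a real sequence with $Q_k=k+O(1)$ and $Q_k>(k-\tfrac12)\frac{\theta}{\pi}$ for all $k\ge1$. For sequences $X=(X_k)_{k\ge1}$ and $Y=(Y_j)_{j\ge1}$ of positive reals put $\phi_j(X,Y)=\frac1\pi\sum_{k\ge1}\theta(X_k,Y_j)$. The operator $T=T_{\theta,Q}$ is defined at $X$ if there is a (necessarily unique) positive sequence $Y$ such that for every $j$ the series $\phi_j(X,Y)$ converges with sum $Q_j$, and then $T(X)=Y$. A fixed point of $T$ is an $X$ at which $T$ is defined with $T(X)=X$; a set $S$ of positive sequences is invariant if $T$ is defined on $S$ and $T(S)\subset S$. Lower-case letters denote coordinatewise logarithms: $x_k=\ln X_k$, $p_k=\ln P_k$, and $T^n(x)$ is the logarithm of $T^n(X)$. For a real sequence $v$ let $\|v\|_\epsilon=\sup_k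 k^\epsilon|v_k|$. Let $U(\alpha,\epsilon)$ be the set of positive sequences $X$ with $x_k=\alpha\ln k+O(k^{-\epsilon})$, let $U^0(\alpha,0)$ be the set of positive sequences $X$ with $x_k=\alpha\ln k+o(1)$, and, for a positive sequence $P$, let $U(P,\epsilon)$ be the set of positive sequences $X$ with $x_k=p_k+O(k^{-\epsilon})$. Theorem. There is a unique $\alpha_\theta>0$ for which $T$ has a fixed point in $U(\alpha_\theta,0)$, namely $\alpha_\theta=1+\theta/\pi$. Moreover: (1) The space $U^0(\alpha_\theta,0)$ is invariant for $T$. (2) There is a fixed point $P\in U(\alpha_\theta,1)$ of $T$, which has the following properties (3)-(5). (3) $P$ is a global attractor in $U^0(\alpha_\theta,0)$: for every $X\in U^0(\alpha_\theta,0)$, $\lim_{n\to\infty}\|T^n(x)-p\|_0=0$. (4) The space $U(P,\epsilon)$ is invariant for $T$ for every $0\le\epsilon<\alpha_\theta+1$. (5) $P$ is a global exponential attractor in $U(P,\epsilon)$ for every $0<\epsilon<2$: there is $\lambda=\lambda(\epsilon)\in(0,1)$ and, for every $R\ge0$, a constant $C=C(\epsilon,R)>0$ such that $\|T^n(x)-p\|_\epsilon\le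 C\lambda^n$ for all $n\ge0$ and all $X\in U(P,\epsilon)$ with $\|x-p\|_\epsilon\le R$. -/

import Mathlib

open Filter Topology

namespace ExactQuantization

noncomputable section

/-! A sequence `(X_k)` indexed by `k = 1, 2, 3, …` is a function `X : ℕ → ℝ`, the entry `X k`
being the one of index `k + 1`. -/

/-- The angle `θ(E', E) = tan⁻¹ (sin θ / (E' / E + cos θ))`, with the branch of the inverse tangent
that takes values in `(0, π)`, i.e. the argument of `E' / E + e^{iθ}`. It is written as an inverse
cotangent, so that it also makes sense (and is continuous) where the denominator vanishes. -/
def angle (θ E' E : ℝ) : ℝ :=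
  Real.pi / 2 - Real.arctan ((E' / E + Real.cos θ) / Real.sin θ)

theorem angle_mem_Ioo (θ E' E : ℝ) : angle θ E' E ∈ Set.Ioo 0 Real.pi := by
  have h1 := Real.arctan_lt_pi_div_two ((E' / E + Real.cos θ) / Real.sin θ)
  have h2 := Real.neg_pi_div_two_lt_arctan ((E' / E + Real.cos θ) / Real.sin θ)
  constructor <;> unfold angle <;> linarith

theorem tan_angle (θ E' E : ℝ) :
    Real.tan (angle θ E' E) = Real.sin θ / (E' / E + Real.cos θ) := by
  rw [angle, Real.tan_pi_div_two_sub, Real.tan_arctan, inv_div]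

/-- `φ(X, Y) = Q` for sequences `X`, `Y` of positive reals, where
`φ_j(X, Y) = (1 / π) ∑_k θ(X_k, Y_j)`; the convergence of the series is part of the condition. -/
def IsImage (θ : ℝ) (Q X Y : ℕ → ℝ) : Prop :=
  (∀ k, 0 < X k) ∧ (∀ j, 0 < Y j) ∧
    ∀ j, HasSum (fun k => 1 / Real.pi * angle θ (X k) (Y j)) (Q j)

/-- The operator `T_{θ,Q}` is defined at `X`. -/
def Defined (θ : ℝ) (Q X : ℕ → ℝ) : Prop := ∃ Y, IsImage θ Q X Y

open Classical in
/-- The operator `T = T_{θ,Q}`: `T X` is the sequence `Y` with `φ(X, Y) = Q`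
(a meaningless value is given where `T` is not defined). -/
def T (θ : ℝ) (Q X : ℕ → ℝ) : ℕ → ℝ :=
  if h : Defined θ Q X then h.choose else 0

theorem angle_lt_angle {θ : ℝ} (h0 : 0 < θ) (hpi : θ < Real.pi) {A E F : ℝ}
    (hA : 0 < A) (hE : 0 < E) (hEF : E < F) : angle θ A E < angle θ A F := by
  have hs : 0 < Real.sin θ := Real.sin_pos_of_pos_of_lt_pi h0 hpi
  have h1 : A / F < A / E := div_lt_div_of_pos_left hA hE hEF
  have h2 : (A / F + Real.cos θ) / Real.sin θ < (A / E + Real.cos θ) / Real.sin θ :=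
    div_lt_div_of_pos_right (by linarith) hs
  have h3 := Real.arctan_strictMono h2
  unfold angle
  linarith

/-- The equation `φ(X, Y) = Q` has at most one solution `Y`, so `T` is well defined. -/
theorem IsImage.unique {θ : ℝ} (h0 : 0 < θ) (hpi : θ < Real.pi) {Q X Y Z : ℕ → ℝ}
    (hY : IsImage θ Q X Y) (hZ : IsImage θ Q X Z) : Y = Z := by
  have key : ∀ {Y Z : ℕ → ℝ}, IsImage θ Q X Y → IsImage θ Q X Z → ∀ j, ¬ Y j < Z j := by
    intro Y Z hY hZ j hlt
    have hp : 0 < 1 / Real.pi := by positivity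
    have hl : ∀ k, 1 / Real.pi * angle θ (X k) (Y j) < 1 / Real.pi * angle θ (X k) (Z j) :=
      fun k => mul_lt_mul_of_pos_left (angle_lt_angle h0 hpi (hY.1 k) (hY.2.1 j) hlt) hp
    exact lt_irrefl _ (hasSum_lt (fun k => (hl k).le) (hl 0) (hY.2.2 j) (hZ.2.2 j))
  funext j
  exact le_antisymm (not_lt.mp (key hZ hY j)) (not_lt.mp (key hY hZ j))

theorem IsImage.T_eq {θ : ℝ} (h0 : 0 < θ) (hpi : θ < Real.pi) {Q X Y : ℕ → ℝ}
    (hY : IsImage θ Q X Y) : T θ Q X = Y := by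
  have h : Defined θ Q X := ⟨Y, hY⟩
  rw [T, dif_pos h]
  exact IsImage.unique h0 hpi h.choose_spec hY

/-- `X` is a fixed point of `T`. -/
def IsFixed (θ : ℝ) (Q X : ℕ → ℝ) : Prop := Defined θ Q X ∧ T θ Q X = X

/-- `S` is invariant for `T`: `T` is defined on all of `S` and maps `S` into `S`. -/
def Invariant (θ : ℝ) (Q : ℕ → ℝ) (S : Set (ℕ → ℝ)) : Prop :=
  ∀ X ∈ S, Defined θ Q X ∧ T θ Q X ∈ S

/-- The coordinatewise logarithm. -/
def logSeq (X : ℕ → ℝ) : ℕ → ℝ := fun k => Real.log (X k)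

/-- The norm `‖v‖_ε = sup_k k^ε |v_k|`, with value `∞` if the supremum is infinite. -/
def wnorm (ε : ℝ) (v : ℕ → ℝ) : ENNReal :=
  ⨆ k : ℕ, ENNReal.ofReal (((k : ℝ) + 1) ^ ε * |v k|)

/-- The space `u(ε)` of sequences `v_k = O(k^{-ε})`. -/
def smallU (ε : ℝ) : Set (ℕ → ℝ) :=
  {v | v =O[atTop] fun k : ℕ => ((k : ℝ) + 1) ^ (-ε)}

/-- The space `u⁰(ε)` of sequences `v_k = o(k^{-ε})`. -/
def smallU0 (ε : ℝ) : Set (ℕ → ℝ) :=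
  {v | v =o[atTop] fun k : ℕ => ((k : ℝ) + 1) ^ (-ε)}

/-- The exponential image of the affine space `u(x, ε) = x + u(ε)`. -/
def expU (x : ℕ → ℝ) (ε : ℝ) : Set (ℕ → ℝ) :=
  {X | (∀ k, 0 < X k) ∧ logSeq X - x ∈ smallU ε}

/-- The exponential image of the affine space `u⁰(x, ε) = x + u⁰(ε)`. -/
def expU0 (x : ℕ → ℝ) (ε : ℝ) : Set (ℕ → ℝ) :=
  {X | (∀ k, 0 < X k) ∧ logSeq X - x ∈ smallU0 ε}

/-- The sequence `(α ln k)`. -/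
def powLog (α : ℝ) : ℕ → ℝ := fun k => α * Real.log ((k : ℝ) + 1)

/-- The space `U(α, ε)`. -/
def powU (α ε : ℝ) : Set (ℕ → ℝ) := expU (powLog α) ε

/-- The space `U⁰(α, ε)`. -/
def powU0 (α ε : ℝ) : Set (ℕ → ℝ) := expU0 (powLog α) ε

/-- The space `U(P, ε)` around a positive sequence `P`. -/
def seqU (P : ℕ → ℝ) (ε : ℝ) : Set (ℕ → ℝ) := expU (logSeq P) ε

end

end ExactQuantization

/-! In logarithmic coordinates the equation T(X) = Y reads ∑_k `phase θ` (x_k - y_j) = π Q_j. The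
function `phase θ` is strictly decreasing, bounded by θ, equal to θ/2 at 0, and decays like e^{-t}.
Hence T is monotone and commutes with adding a constant to x, so it does not increase sup distances.
It is defined whenever ∑ e^{-x_k} converges.

The exponent. For x_k = a ln k the sum at y_j = a ln m is, up to a bounded error, m times the
integral of s ↦ `angle θ (s ^ a) 1` over (0, ∞). Integration by parts turns this integral into the
imaginary part of `sectorIntegral`, which satisfies I' = (i/a) I in the angle, so the integral is a
constant times sin(θ/a). Letting the angle tend to π fixes the constant, and the integral becomes π
sin(θ/a) / sin(π/a). It equals π for a = 1 + θ/π, because then θ/a + π/a = π.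

Existence and attraction. Shifting the index of (α ln k) by N changes the sums by about πN and costs
at most θN, so for large N the forward shift is a supersolution. The backward shift, with N widely
spaced low terms put in front, is a subsolution; at those first terms this is exactly the lower
bound assumed on Q. The monotone orbits of the two shifts converge to fixed points. By a maximum
principle, two fixed points whose difference tends to 0 coincide, and a difference tending to -∞ is
impossible, which gives uniqueness of the exponent. Any x = α ln k + o(1) is enclosed by such shifts
up to δ, so its orbit is squeezed onto p. Both shifts differ from α ln k by O(1/k), whence P ∈ U(α,
1).

Exponential rate. By the mean value theorem the perturbation y_j - p_j is an average of the x_k -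
p_k with weights close to `phaseDensity θ` (p_k - p_j). Averages of k^{-ε}, divided by j^{-ε},
converge as Riemann sums to `densityMoment θ ε / densityMoment θ 0`; the integrals converge for 0 ≤
ε < α + 1, which gives the invariance (4). The symmetry s ↦ 1/s makes the moments at ε = 0 and ε = 2
equal, and strict convexity in ε makes the ratio less than 1 in between. Flattening the weight at
small indices gives a genuine contraction near p (`Admissible.exists_local_contraction`). Global
attraction of the two extreme points of a ball brings the whole ball into the region of contraction
in a number of steps that depends only on its radius. -/

namespace ExactQuantization

noncomputable section

/-! ### The angle in logarithmic coordinates -/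

/-- The angle `angle θ E' E` as a function of `t = ln (E' / E)`. -/
def phase (θ t : ℝ) : ℝ := angle θ (Real.exp t) 1

/-- The negative of the derivative of `phase θ`. -/
def phaseDensity (θ t : ℝ) : ℝ := Real.sin θ / (2 * (Real.cosh t + Real.cos θ))

theorem angle_exp_exp (θ x y : ℝ) : angle θ (Real.exp x) (Real.exp y) = phase θ (x - y) := by
  simp [phase, angle, Real.exp_sub]

theorem phase_pos (θ t : ℝ) : 0 < phase θ t := (angle_mem_Ioo _ _ _).1

theorem angle_antitone {θ : ℝ} (h0 : 0 < θ) (hpi : θ < Real.pi) {u v : ℝ} (huv : u ≤ v) :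
    angle θ v 1 ≤ angle θ u 1 := by
  have hs : 0 < Real.sin θ := Real.sin_pos_of_pos_of_lt_pi h0 hpi
  have : Real.arctan ((u / 1 + Real.cos θ) / Real.sin θ)
      ≤ Real.arctan ((v / 1 + Real.cos θ) / Real.sin θ) := by
    apply Real.arctan_strictMono.monotone
    gcongr
  unfold angle
  linarith

theorem angle_zero {θ : ℝ} (h0 : 0 < θ) (hpi : θ < Real.pi) : angle θ 0 1 = θ := by
  have : (0 / 1 + Real.cos θ) / Real.sin θ = Real.tan (Real.pi / 2 - θ) := by
    rw [Real.tan_pi_div_two_sub, Real.tan_eq_sin_div_cos, inv_div]; simp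
  rw [angle, this, Real.arctan_tan (by linarith) (by linarith)]
  ring

theorem angle_one {θ : ℝ} (h0 : 0 < θ) (hpi : θ < Real.pi) : angle θ 1 1 = θ / 2 := by
  have hc : 0 < Real.cos (θ / 2) := Real.cos_pos_of_mem_Ioo ⟨by linarith, by linarith⟩
  have hs : 0 < Real.sin (θ / 2) := Real.sin_pos_of_pos_of_lt_pi (by linarith) (by linarith)
  have : (1 / 1 + Real.cos θ) / Real.sin θ = Real.tan (Real.pi / 2 - θ / 2) := by
    rw [Real.tan_pi_div_two_sub, Real.tan_eq_sin_div_cos, inv_div]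
    have e1 : Real.cos θ = 2 * Real.cos (θ / 2) ^ 2 - 1 := by
      rw [← Real.cos_two_mul]; ring_nf
    have e2 : Real.sin θ = 2 * Real.sin (θ / 2) * Real.cos (θ / 2) := by
      rw [← Real.sin_two_mul]; ring_nf
    rw [e1, e2]
    field_simp
    ring
  rw [angle, this, Real.arctan_tan (by linarith) (by linarith)]
  ring

theorem arctan_le_self_of_nonneg {x : ℝ} (hx : 0 ≤ x) : Real.arctan x ≤ x := by
  have := Real.le_tan (Real.arctan_nonneg.2 hx) (Real.arctan_lt_pi_div_two x)
  rwa [Real.tan_arctan] at this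

/-- The constant does not depend on θ, so this bound can serve as a dominating function while θ
tends to π. Small u uses only that the angle is below π; large u uses arctan z ≤ z for the inverse
of the cotangent. -/
theorem angle_le_div {θ : ℝ} (h0 : 0 < θ) (hpi : θ < Real.pi) {u : ℝ} (hu : 0 ≤ u) :
    angle θ u 1 ≤ 3 * Real.pi / (1 + u) := by
  have hs : 0 < Real.sin θ := Real.sin_pos_of_pos_of_lt_pi h0 hpi
  have hπ := Real.pi_gt_three
  rcases le_or_gt u 2 with h2 | h2
  · refine (angle_mem_Ioo θ u 1).2.le.trans ?_
    rw [le_div_iff₀ (by linarith)]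
    nlinarith
  · have hc := Real.neg_one_le_cos θ
    have hz : u - 1 ≤ (u / 1 + Real.cos θ) / Real.sin θ := by
      rw [le_div_iff₀ hs, div_one]
      nlinarith [Real.sin_le_one θ]
    have hz0 : 0 < (u / 1 + Real.cos θ) / Real.sin θ := by linarith
    rw [angle, ← Real.arctan_inv_of_pos hz0]
    calc _ ≤ ((u / 1 + Real.cos θ) / Real.sin θ)⁻¹ := arctan_le_self_of_nonneg (by positivity)
      _ ≤ (u - 1)⁻¹ := inv_anti₀ (by linarith) hz
      _ ≤ 3 / (1 + u) := by
        rw [inv_eq_one_div, div_le_div_iff₀ (by linarith) (by linarith)]; linarith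
      _ ≤ _ := by gcongr; linarith

theorem phase_antitone {θ : ℝ} (h0 : 0 < θ) (hpi : θ < Real.pi) : Antitone (phase θ) :=
  fun _ _ h => angle_antitone h0 hpi (Real.exp_le_exp.2 h)

theorem phase_strictAnti {θ : ℝ} (h0 : 0 < θ) (hpi : θ < Real.pi) : StrictAnti (phase θ) := by
  intro s t h
  have hs : 0 < Real.sin θ := Real.sin_pos_of_pos_of_lt_pi h0 hpi
  have : Real.arctan ((Real.exp s / 1 + Real.cos θ) / Real.sin θ)
      < Real.arctan ((Real.exp t / 1 + Real.cos θ) / Real.sin θ) := by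
    apply Real.arctan_strictMono
    gcongr
  unfold phase angle
  linarith

theorem phase_le {θ : ℝ} (h0 : 0 < θ) (hpi : θ < Real.pi) (t : ℝ) : phase θ t ≤ θ :=
  (angle_antitone h0 hpi (Real.exp_pos t).le).trans_eq (angle_zero h0 hpi)

theorem phase_zero {θ : ℝ} (h0 : 0 < θ) (hpi : θ < Real.pi) : phase θ 0 = θ / 2 := by
  rw [phase, Real.exp_zero, angle_one h0 hpi]

theorem phase_le_exp {θ : ℝ} (h0 : 0 < θ) (hpi : θ < Real.pi) (t : ℝ) :
    phase θ t ≤ 3 * Real.pi * Real.exp (-t) := by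
  refine (angle_le_div h0 hpi (Real.exp_pos t).le).trans ?_
  have := Real.pi_pos
  rw [Real.exp_neg, ← div_eq_mul_inv]
  gcongr
  linarith

theorem cosh_add_cos_pos {θ : ℝ} (h0 : 0 < θ) (hpi : θ < Real.pi) (t : ℝ) :
    0 < Real.cosh t + Real.cos θ := by
  have h1 := Real.one_le_cosh t
  have h2 : -1 < Real.cos θ := by
    rw [← Real.cos_pi]
    exact Real.cos_lt_cos_of_nonneg_of_le_pi h0.le le_rfl hpi
  linarith

theorem angle_hasDerivAt {θ : ℝ} (h0 : 0 < θ) (hpi : θ < Real.pi) (u : ℝ) :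
    HasDerivAt (fun u => angle θ u 1) (-(Real.sin θ / (u ^ 2 + 2 * u * Real.cos θ + 1))) u := by
  have hs : 0 < Real.sin θ := Real.sin_pos_of_pos_of_lt_pi h0 hpi
  have h1 : HasDerivAt (fun u : ℝ => (u / 1 + Real.cos θ) / Real.sin θ) (1 / Real.sin θ) u := by
    simpa using ((hasDerivAt_id u).add_const (Real.cos θ)).div_const (Real.sin θ)
  have h2 := (h1.arctan).const_sub (Real.pi / 2)
  refine h2.congr_deriv ?_
  have e : Real.sin θ ^ 2 + Real.cos θ ^ 2 = 1 := Real.sin_sq_add_cos_sq θ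
  have h3 : 0 < 1 + ((u / 1 + Real.cos θ) / Real.sin θ) ^ 2 := by positivity
  have h4 : u ^ 2 + 2 * u * Real.cos θ + 1
      = Real.sin θ ^ 2 * (1 + ((u / 1 + Real.cos θ) / Real.sin θ) ^ 2) := by
    field_simp
    linear_combination (-1 : ℝ) * e
  rw [h4]
  field_simp

theorem phaseDensity_eq (θ t : ℝ) :
    phaseDensity θ t
      = Real.sin θ / (Real.exp t ^ 2 + 2 * Real.exp t * Real.cos θ + 1) * Real.exp t := by
  have h : Real.exp t ^ 2 + 2 * Real.exp t * Real.cos θ + 1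
      = (2 * (Real.cosh t + Real.cos θ)) * Real.exp t := by
    rw [Real.cosh_eq, Real.exp_neg]
    field_simp
    ring
  rw [phaseDensity, h, div_mul_eq_mul_div, mul_div_mul_right _ _ (Real.exp_pos t).ne']

theorem phase_hasDerivAt {θ : ℝ} (h0 : 0 < θ) (hpi : θ < Real.pi) (t : ℝ) :
    HasDerivAt (phase θ) (-phaseDensity θ t) t := by
  refine ((angle_hasDerivAt h0 hpi (Real.exp t)).comp t (Real.hasDerivAt_exp t)).congr_deriv ?_
  rw [phaseDensity_eq, neg_mul]

theorem phase_continuous {θ : ℝ} (h0 : 0 < θ) (hpi : θ < Real.pi) : Continuous (phase θ) :=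
  continuous_iff_continuousAt.2 fun t => (phase_hasDerivAt h0 hpi t).continuousAt

theorem phaseDensity_pos {θ : ℝ} (h0 : 0 < θ) (hpi : θ < Real.pi) (t : ℝ) :
    0 < phaseDensity θ t :=
  div_pos (Real.sin_pos_of_pos_of_lt_pi h0 hpi) (mul_pos two_pos (cosh_add_cos_pos h0 hpi t))

theorem phaseDensity_neg (θ t : ℝ) : phaseDensity θ (-t) = phaseDensity θ t := by
  rw [phaseDensity, phaseDensity, Real.cosh_neg]

theorem phaseDensity_continuous {θ : ℝ} (h0 : 0 < θ) (hpi : θ < Real.pi) :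
    Continuous (phaseDensity θ) := by
  unfold phaseDensity
  refine Continuous.div (by fun_prop) (by fun_prop) fun t => ?_
  exact (mul_pos two_pos (cosh_add_cos_pos h0 hpi t)).ne'

/-- Near the diagonal the density changes by a factor close to `1`. -/
theorem exists_phaseDensity_mul_le {θ : ℝ} (h0 : 0 < θ) (hpi : θ < Real.pi) :
    ∃ c : ℝ, 0 < c ∧ ∀ s t D : ℝ, |s - t| ≤ D →
      phaseDensity θ s ≤ (1 + c * (Real.exp D - 1)) * phaseDensity θ t := by
  have hs : 0 < Real.sin θ := Real.sin_pos_of_pos_of_lt_pi h0 hpi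
  have hc : |Real.cos θ| < 1 := by
    rw [abs_lt]
    have := Real.sin_sq_add_cos_sq θ
    constructor <;> nlinarith
  refine ⟨(1 - |Real.cos θ|)⁻¹, by rw [inv_pos]; linarith, fun s t D hD => ?_⟩
  have hcs := cosh_add_cos_pos h0 hpi s
  have hct := cosh_add_cos_pos h0 hpi t
  -- Since cosh ≥ 1 and |cos θ| < 1, the denominator is comparable to cosh s, whose relative
  -- variation is at most e^D.
  have hlow : (1 - |Real.cos θ|) * Real.cosh s ≤ Real.cosh s + Real.cos θ := by
    nlinarith [neg_abs_le (Real.cos θ), Real.one_le_cosh s, abs_nonneg (Real.cos θ)]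
  have hD0 : 0 ≤ D := (abs_nonneg _).trans hD
  have hE : 0 ≤ Real.exp D - 1 := by linarith [Real.add_one_le_exp D]
  have hup : Real.cosh t ≤ Real.exp D * Real.cosh s := by
    have h1 : Real.exp t ≤ Real.exp D * Real.exp s := by
      rw [← Real.exp_add]; apply Real.exp_le_exp.2; linarith [neg_abs_le (s - t)]
    have h2 : Real.exp (-t) ≤ Real.exp D * Real.exp (-s) := by
      rw [← Real.exp_add]; apply Real.exp_le_exp.2; linarith [le_abs_self (s - t)]
    rw [Real.cosh_eq, Real.cosh_eq]; linarith
  have key : Real.cosh t + Real.cos θ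
      ≤ (1 + (1 - |Real.cos θ|)⁻¹ * (Real.exp D - 1)) * (Real.cosh s + Real.cos θ) := by
    have h3 : Real.cosh s ≤ (1 - |Real.cos θ|)⁻¹ * (Real.cosh s + Real.cos θ) := by
      rw [inv_mul_eq_div, le_div_iff₀ (by linarith)]; linarith
    nlinarith
  unfold phaseDensity
  rw [← mul_div_assoc, div_le_div_iff₀ (by linarith) (by linarith)]
  nlinarith

theorem phaseDensity_le_exp {θ : ℝ} (h0 : 0 < θ) (hpi : θ < Real.pi) (t : ℝ) :
    phaseDensity θ t ≤ (Real.sin θ)⁻¹ * Real.exp (-|t|) := by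
  have hs : 0 < Real.sin θ := Real.sin_pos_of_pos_of_lt_pi h0 hpi
  have aux : ∀ t : ℝ, phaseDensity θ t ≤ (Real.sin θ)⁻¹ * Real.exp (-t) := by
    intro t
    have h1 := Real.sin_sq_add_cos_sq θ
    -- The difference of the two sides is (e^t cos θ + 1)².
    have h2 : Real.sin θ ^ 2 * Real.exp t ^ 2 ≤
        Real.exp t ^ 2 + 2 * Real.exp t * Real.cos θ + 1 := by
      nlinarith [sq_nonneg (Real.exp t * Real.cos θ + 1)]
    have h3 := Real.exp_pos t
    rw [phaseDensity_eq, Real.exp_neg, div_mul_eq_mul_div, ← mul_inv, ← one_div]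
    rw [div_le_div_iff₀ (lt_of_lt_of_le (by positivity) h2) (by positivity)]
    calc _ = Real.sin θ ^ 2 * Real.exp t ^ 2 := by ring
      _ ≤ _ := by linarith
  rcases abs_cases t with ⟨h, -⟩ | ⟨h, -⟩
  · rw [h]; exact aux t
  · rw [h, ← phaseDensity_neg]; exact aux (-t)

/-! ### The integral of the angle along `s ↦ s ^ a` -/

open MeasureTheory Set in
theorem integrableOn_inv_one_add_rpow {a : ℝ} (ha : 1 < a) :
    IntegrableOn (fun s : ℝ => (1 + s ^ a)⁻¹) (Ioi 0) := by
  have hm : AEStronglyMeasurable (fun s : ℝ => (1 + s ^ a)⁻¹) := by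
    apply Measurable.aestronglyMeasurable
    fun_prop
  rw [← Ioc_union_Ioi_eq_Ioi (zero_le_one (α := ℝ))]
  refine IntegrableOn.union ?_ ?_
  · refine Integrable.mono' (g := fun _ => (1 : ℝ)) (by simp) hm.restrict ?_
    filter_upwards [ae_restrict_mem measurableSet_Ioc] with s hs
    have : 0 ≤ s ^ a := Real.rpow_nonneg hs.1.le a
    rw [Real.norm_of_nonneg (by positivity)]
    exact inv_le_one_of_one_le₀ (by linarith)
  · refine Integrable.mono' (integrableOn_Ioi_rpow_of_lt (neg_lt_neg ha) one_pos) hm.restrict ?_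
    filter_upwards [ae_restrict_mem measurableSet_Ioi] with s hs
    have hs0 : 0 < s := one_pos.trans hs
    have : 0 < s ^ a := Real.rpow_pos_of_pos hs0 a
    rw [Real.norm_of_nonneg (by positivity), Real.rpow_neg hs0.le]
    exact inv_anti₀ this (by linarith)

theorem tendsto_mul_inv_one_add_rpow {a : ℝ} (ha : 1 < a) :
    Tendsto (fun s : ℝ => s * (1 + s ^ a)⁻¹) atTop (𝓝 0) := by
  have h := tendsto_rpow_neg_atTop (y := a - 1) (by linarith)
  refine squeeze_zero' ?_ ?_ h
  · filter_upwards [eventually_gt_atTop 0] with s hs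
    have : 0 < s ^ a := Real.rpow_pos_of_pos hs a
    positivity
  · filter_upwards [eventually_gt_atTop 0] with s hs
    have : 0 < s ^ a := Real.rpow_pos_of_pos hs a
    rw [neg_sub, Real.rpow_sub hs, Real.rpow_one, div_eq_mul_inv]
    gcongr
    linarith

/-- The squared norm exceeds the square of the left side by sin²(φ/2) (r - 1)². -/
theorem cos_half_mul_le_norm (φ r : ℝ) :
    Real.cos (φ / 2) * (1 + r) ≤ ‖(r : ℂ) + Complex.exp (φ * Complex.I)‖ := by
  have h1 : ‖(r : ℂ) + Complex.exp (φ * Complex.I)‖ ^ 2 = r ^ 2 + 2 * r * Real.cos φ + 1 := by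
    rw [← Complex.normSq_eq_norm_sq, Complex.normSq_apply]
    have := Real.sin_sq_add_cos_sq φ
    simp only [Complex.add_re, Complex.ofReal_re, Complex.add_im, Complex.ofReal_im,
      Complex.exp_ofReal_mul_I_re, Complex.exp_ofReal_mul_I_im]
    linear_combination this
  have h2 : Real.cos φ = 2 * Real.cos (φ / 2) ^ 2 - 1 := by
    rw [← Real.cos_two_mul]; ring_nf
  refine le_of_sq_le_sq ?_ (norm_nonneg _)
  rw [h1, h2]
  nlinarith [mul_nonneg (sub_nonneg.2 (Real.cos_sq_le_one (φ / 2))) (sq_nonneg (r - 1))]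

/-- The integrand `w / (s ^ a + w)` at `w = e ^ (i φ)`. -/
def sectorKernel (a φ s : ℝ) : ℂ :=
  Complex.exp (φ * Complex.I) / ((s ^ a : ℝ) + Complex.exp (φ * Complex.I))

/-- The integral of `sectorKernel`. -/
def sectorIntegral (a φ : ℝ) : ℂ := ∫ s in Set.Ioi (0 : ℝ), sectorKernel a φ s

theorem cos_half_pos {φ : ℝ} (hφ : φ ∈ Set.Ioo (-Real.pi) Real.pi) : 0 < Real.cos (φ / 2) :=
  Real.cos_pos_of_mem_Ioo ⟨by linarith [hφ.1], by linarith [hφ.2]⟩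

theorem rpow_add_exp_ne_zero {a φ s : ℝ} (hφ : φ ∈ Set.Ioo (-Real.pi) Real.pi) (hs : 0 ≤ s) :
    ((s ^ a : ℝ) : ℂ) + Complex.exp (φ * Complex.I) ≠ 0 := by
  have h := cos_half_mul_le_norm φ (s ^ a)
  have h2 := mul_pos (cos_half_pos hφ) (by linarith [Real.rpow_nonneg hs a] : 0 < 1 + s ^ a)
  exact norm_pos_iff.1 (h2.trans_le h)

theorem norm_sectorKernel_le {a φ s : ℝ} (hφ : φ ∈ Set.Ioo (-Real.pi) Real.pi) (hs : 0 ≤ s) :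
    ‖sectorKernel a φ s‖ ≤ (Real.cos (φ / 2))⁻¹ * (1 + s ^ a)⁻¹ := by
  have h := cos_half_mul_le_norm φ (s ^ a)
  have h2 := mul_pos (cos_half_pos hφ) (by linarith [Real.rpow_nonneg hs a] : 0 < 1 + s ^ a)
  rw [sectorKernel, norm_div, Complex.norm_exp_ofReal_mul_I, ← mul_inv, one_div]
  exact inv_anti₀ h2 h

theorem measurable_sectorKernel (a φ : ℝ) : Measurable (sectorKernel a φ) := by
  unfold sectorKernel
  fun_prop

open MeasureTheory Set in
theorem integrableOn_sectorKernel {a φ : ℝ} (ha : 1 < a) (hφ : φ ∈ Ioo (-Real.pi) Real.pi) :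
    IntegrableOn (sectorKernel a φ) (Ioi 0) := by
  refine Integrable.mono' ((integrableOn_inv_one_add_rpow ha).const_mul (Real.cos (φ / 2))⁻¹)
    (measurable_sectorKernel a φ).aestronglyMeasurable ?_
  filter_upwards [ae_restrict_mem measurableSet_Ioi] with s hs
  exact norm_sectorKernel_le hφ (le_of_lt hs)

/-- The kernel K depends only on s^a e^{-iφ}, so ∂_φ K and s ∂_s K are both multiples of K - K².
This proportionality yields the differential equation for the integral. -/
theorem hasDerivAt_sectorKernel_angle {a φ s : ℝ} (hφ : φ ∈ Set.Ioo (-Real.pi) Real.pi)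
    (hs : 0 ≤ s) :
    HasDerivAt (fun φ => sectorKernel a φ s)
      (Complex.I * (sectorKernel a φ s - sectorKernel a φ s ^ 2)) φ := by
  have hne := rpow_add_exp_ne_zero (a := a) hφ hs
  have h1 : HasDerivAt (fun φ : ℝ => Complex.exp (φ * Complex.I))
      (Complex.exp (φ * Complex.I) * Complex.I) φ := by
    have := ((Complex.ofRealCLM.hasDerivAt (x := φ)).mul_const Complex.I).cexp
    simpa using this
  have h2 := h1.div (h1.const_add ((s ^ a : ℝ) : ℂ)) hne
  refine h2.congr_deriv ?_
  unfold sectorKernel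
  field_simp

theorem hasDerivAt_mul_sectorKernel {a φ s : ℝ} (hφ : φ ∈ Set.Ioo (-Real.pi) Real.pi)
    (hs : 0 < s) :
    HasDerivAt (fun s : ℝ => (s : ℂ) * sectorKernel a φ s)
      (sectorKernel a φ s - a * (sectorKernel a φ s - sectorKernel a φ s ^ 2)) s := by
  have hne := rpow_add_exp_ne_zero (a := a) hφ hs.le
  have h1 : HasDerivAt (fun s : ℝ => ((s ^ a : ℝ) : ℂ)) ((a * s ^ (a - 1) : ℝ) : ℂ) s := by
    have := (Real.hasDerivAt_rpow_const (x := s) (p := a) (Or.inl hs.ne')).ofReal_comp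
    simpa using this
  have h2 := (h1.add_const (Complex.exp (φ * Complex.I))).fun_inv hne
  have h3 := (Complex.ofRealCLM.hasDerivAt (x := s)).mul
    (h2.const_mul (Complex.exp (φ * Complex.I)))
  have e : ((s ^ a : ℝ) : ℂ) = s * ((s ^ (a - 1) : ℝ) : ℂ) := by
    rw [← Complex.ofReal_mul, mul_comm, ← Real.rpow_add_one hs.ne', sub_add_cancel]
  refine (h3.congr_deriv ?_)
  unfold sectorKernel
  simp only [Complex.ofRealCLM_apply, Complex.ofReal_one, Complex.ofReal_mul]
  rw [e] at hne ⊢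
  field_simp
  ring

-- Integrate the derivative of s K(s) over (0, ∞); both boundary terms vanish because a > 1.
open MeasureTheory Set in
theorem sectorIntegral_sub {a φ : ℝ} (ha : 1 < a) (hφ : φ ∈ Ioo (-Real.pi) Real.pi) :
    IntegrableOn (fun s => sectorKernel a φ s ^ 2) (Ioi 0) ∧
    ∫ s in Ioi (0 : ℝ), (sectorKernel a φ s - sectorKernel a φ s ^ 2)
      = sectorIntegral a φ / a := by
  have hi := integrableOn_sectorKernel ha hφ
  have hc := cos_half_pos hφ
  have hsq : IntegrableOn (fun s => sectorKernel a φ s ^ 2) (Ioi 0) := by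
    refine Integrable.mono' (hi.norm.const_mul (Real.cos (φ / 2))⁻¹)
      ((measurable_sectorKernel a φ).pow_const 2).aestronglyMeasurable ?_
    filter_upwards [ae_restrict_mem measurableSet_Ioi] with s hs
    have h1 := norm_sectorKernel_le (a := a) hφ (le_of_lt hs)
    have h2 : (1 + s ^ a)⁻¹ ≤ 1 :=
      inv_le_one_of_one_le₀ (by linarith [Real.rpow_nonneg (le_of_lt hs) a])
    have h3 : 0 < (Real.cos (φ / 2))⁻¹ := inv_pos.2 hc
    rw [norm_pow, sq]
    gcongr
    nlinarith
  refine ⟨hsq, ?_⟩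
  have hcont : ContinuousWithinAt (fun s : ℝ => (s : ℂ) * sectorKernel a φ s) (Ici 0) 0 := by
    refine ContinuousWithinAt.mul (by fun_prop) ?_
    unfold sectorKernel
    refine ContinuousWithinAt.div (by fun_prop) ?_ (rpow_add_exp_ne_zero hφ le_rfl)
    refine ContinuousWithinAt.add ?_ (by fun_prop)
    refine Complex.continuous_ofReal.continuousAt.comp_continuousWithinAt ?_
    exact (Real.continuousAt_rpow_const 0 a (Or.inr (by linarith))).continuousWithinAt
  have hlim : Tendsto (fun s : ℝ => (s : ℂ) * sectorKernel a φ s) atTop (𝓝 0) := by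
    have := (tendsto_mul_inv_one_add_rpow ha).const_mul (Real.cos (φ / 2))⁻¹
    rw [mul_zero] at this
    refine squeeze_zero_norm' ?_ this
    filter_upwards [eventually_ge_atTop 0] with s hs
    rw [norm_mul, Complex.norm_real, Real.norm_of_nonneg hs]
    calc _ ≤ s * ((Real.cos (φ / 2))⁻¹ * (1 + s ^ a)⁻¹) := by
          gcongr; exact norm_sectorKernel_le hφ hs
      _ = _ := by ring
  have key := integral_Ioi_of_hasDerivAt_of_tendsto hcont
    (fun s hs => hasDerivAt_mul_sectorKernel (a := a) hφ hs)
    (hi.sub ((hi.sub hsq).const_mul (a : ℂ))) hlim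
  have e : ∫ s in Ioi (0 : ℝ), (sectorKernel a φ s
      - (a : ℂ) * (sectorKernel a φ s - sectorKernel a φ s ^ 2))
      = sectorIntegral a φ - a * ∫ s in Ioi (0 : ℝ), (sectorKernel a φ s - sectorKernel a φ s ^ 2) := by
    have hd : IntegrableOn (fun s => (a : ℂ) * (sectorKernel a φ s - sectorKernel a φ s ^ 2))
        (Ioi 0) := (hi.sub hsq).const_mul (a : ℂ)
    rw [integral_sub hi hd, integral_const_mul]
    rfl
  rw [e] at key
  have ha0 : (a : ℂ) ≠ 0 := by exact_mod_cast (by linarith : a ≠ 0)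
  rw [eq_div_iff ha0]
  simp only [Complex.ofReal_zero, zero_mul, sub_zero] at key
  linear_combination -key

open MeasureTheory Set in
theorem hasDerivAt_sectorIntegral {a φ : ℝ} (ha : 1 < a) (hφ : φ ∈ Ioo (-Real.pi) Real.pi) :
    HasDerivAt (sectorIntegral a) (Complex.I / a * sectorIntegral a φ) φ := by
  -- A lower bound for cos(ψ/2) that is uniform near φ makes the domination of the derivatives
  -- independent of ψ.
  obtain ⟨c, hc0, hc⟩ : ∃ c : ℝ, 0 < c ∧
      ∀ᶠ ψ in 𝓝 φ, ψ ∈ Ioo (-Real.pi) Real.pi ∧ c ≤ Real.cos (ψ / 2) := by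
    refine ⟨Real.cos (φ / 2) / 2, by linarith [cos_half_pos hφ], ?_⟩
    have h0 : ∀ᶠ ψ in 𝓝 φ, ψ ∈ Ioo (-Real.pi) Real.pi := isOpen_Ioo.mem_nhds hφ
    refine h0.and ?_
    have h1 : Tendsto (fun ψ : ℝ => Real.cos (ψ / 2)) (𝓝 φ) (𝓝 (Real.cos (φ / 2))) :=
      Continuous.tendsto (by fun_prop) φ
    have h2 : Real.cos (φ / 2) / 2 < Real.cos (φ / 2) := by linarith [cos_half_pos hφ]
    filter_upwards [h1.eventually (lt_mem_nhds h2)] with ψ h using h.le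
  have h := hasDerivAt_integral_of_dominated_loc_of_deriv_le
    (μ := volume.restrict (Ioi (0 : ℝ))) (F := fun φ s => sectorKernel a φ s)
    (F' := fun φ s => Complex.I * (sectorKernel a φ s - sectorKernel a φ s ^ 2))
    (x₀ := φ) (bound := fun s => (c⁻¹ + c⁻¹ ^ 2) * (1 + s ^ a)⁻¹) hc
    (Eventually.of_forall fun ψ => (measurable_sectorKernel a ψ).aestronglyMeasurable)
    (integrableOn_sectorKernel ha hφ)
    (((measurable_sectorKernel a φ).sub
      ((measurable_sectorKernel a φ).pow_const 2)).const_mul Complex.I).aestronglyMeasurable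
    ?_ ((integrableOn_inv_one_add_rpow ha).const_mul _) ?_
  · refine h.2.congr_deriv ?_
    rw [integral_const_mul, (sectorIntegral_sub ha hφ).2]
    ring
  · filter_upwards [ae_restrict_mem measurableSet_Ioi] with s hs ψ hψ
    have h1 := norm_sectorKernel_le (a := a) hψ.1 (le_of_lt hs)
    have hr := Real.rpow_nonneg (le_of_lt hs) a
    have h0 : 0 < (1 + s ^ a)⁻¹ := inv_pos.2 (by linarith)
    have h2 : (1 + s ^ a)⁻¹ ≤ 1 := inv_le_one_of_one_le₀ (by linarith)
    have h3 : (Real.cos (ψ / 2))⁻¹ ≤ c⁻¹ := inv_anti₀ hc0 hψ.2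
    have h4 : ‖sectorKernel a ψ s‖ ≤ c⁻¹ * (1 + s ^ a)⁻¹ := h1.trans (by gcongr)
    have h5 : 0 < c⁻¹ := inv_pos.2 hc0
    rw [norm_mul, Complex.norm_I, one_mul]
    refine (norm_sub_le _ _).trans ?_
    rw [norm_pow]
    have h6 : ‖sectorKernel a ψ s‖ ^ 2 ≤ c⁻¹ ^ 2 * (1 + s ^ a)⁻¹ := by
      refine (pow_le_pow_left₀ (norm_nonneg _) h4 2).trans ?_
      rw [mul_pow]
      gcongr
      nlinarith
    linarith
  · filter_upwards [ae_restrict_mem measurableSet_Ioi] with s hs ψ hψ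
    exact hasDerivAt_sectorKernel_angle hψ.1 (le_of_lt hs)

/-- By the differential equation, e^{-iφ/a} I(φ) has zero derivative on (-π, π). -/
theorem sectorIntegral_eq {a φ : ℝ} (ha : 1 < a) (hφ : φ ∈ Set.Ioo (-Real.pi) Real.pi) :
    sectorIntegral a φ = sectorIntegral a 0 * Complex.exp ((φ / a : ℝ) * Complex.I) := by
  have hpos := Real.pi_pos
  have hd : ∀ ψ ∈ Set.Ioo (-Real.pi) Real.pi,
      HasDerivAt (fun ψ : ℝ => sectorIntegral a ψ * Complex.exp ((-(ψ / a) : ℝ) * Complex.I))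
        0 ψ := by
    intro ψ hψ
    have h1 : HasDerivAt (fun ψ : ℝ => Complex.exp ((-(ψ / a) : ℝ) * Complex.I))
        (Complex.exp ((-(ψ / a) : ℝ) * Complex.I) * (((-(1 / a) : ℝ) : ℂ) * Complex.I)) ψ :=
      ((((hasDerivAt_id ψ).div_const a).neg.ofReal_comp).mul_const Complex.I).cexp
    refine ((hasDerivAt_sectorIntegral ha hψ).mul h1).congr_deriv ?_
    push_cast
    ring
  have hconst := isOpen_Ioo.is_const_of_deriv_eq_zero (𝕜 := ℝ) isPreconnected_Ioo
    (fun ψ hψ => (hd ψ hψ).differentiableAt.differentiableWithinAt)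
    (fun ψ hψ => (hd ψ hψ).deriv) hφ (⟨by linarith, hpos⟩ : (0 : ℝ) ∈ Set.Ioo (-Real.pi) Real.pi)
  simp only [zero_div, neg_zero, Complex.ofReal_zero, zero_mul, Complex.exp_zero, mul_one] at hconst
  rw [← hconst, mul_assoc, ← Complex.exp_add]
  simp

theorem sectorIntegral_zero_im (a : ℝ) : (sectorIntegral a 0).im = 0 := by
  have h : sectorIntegral a 0 = ((∫ s in Set.Ioi (0 : ℝ), 1 / (s ^ a + 1) : ℝ) : ℂ) := by
    rw [sectorIntegral, ← integral_complex_ofReal]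
    simp [sectorKernel]
  rw [h, Complex.ofReal_im]

theorem sectorKernel_im {a φ s : ℝ} :
    (sectorKernel a φ s).im
      = Real.sin φ / ((s ^ a) ^ 2 + 2 * s ^ a * Real.cos φ + 1) * s ^ a := by
  have := Real.sin_sq_add_cos_sq φ
  rw [sectorKernel, Complex.div_im, Complex.normSq_apply]
  simp only [Complex.add_re, Complex.ofReal_re, Complex.add_im, Complex.ofReal_im,
    Complex.exp_ofReal_mul_I_re, Complex.exp_ofReal_mul_I_im]
  have e : (s ^ a + Real.cos φ) * (s ^ a + Real.cos φ) + (0 + Real.sin φ) * (0 + Real.sin φ)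
    = (s ^ a) ^ 2 + 2 * s ^ a * Real.cos φ + 1 := by linear_combination this
  rw [e]
  ring

open MeasureTheory Set in
theorem integrableOn_angle_rpow {a θ : ℝ} (ha : 1 < a) (h0 : 0 < θ) (hpi : θ < Real.pi) :
    IntegrableOn (fun s : ℝ => angle θ (s ^ a) 1) (Ioi 0) := by
  refine Integrable.mono' ((integrableOn_inv_one_add_rpow ha).const_mul (3 * Real.pi)) ?_ ?_
  · apply Measurable.aestronglyMeasurable
    unfold angle
    fun_prop
  · filter_upwards [ae_restrict_mem measurableSet_Ioi] with s hs
    rw [Real.norm_of_nonneg (angle_mem_Ioo _ _ _).1.le]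
    exact angle_le_div h0 hpi (Real.rpow_nonneg (le_of_lt hs) a)

-- Integration by parts: the derivative of s · `angle θ (s ^ a) 1` is the angle minus a times the
-- imaginary part of the kernel, and the boundary terms vanish.
open MeasureTheory Set in
theorem integral_angle_rpow_eq_im {a θ : ℝ} (ha : 1 < a) (h0 : 0 < θ) (hpi : θ < Real.pi) :
    ∫ s in Ioi (0 : ℝ), angle θ (s ^ a) 1 = a * (sectorIntegral a θ).im := by
  have hθ : θ ∈ Ioo (-Real.pi) Real.pi := ⟨by linarith, hpi⟩
  have hi := integrableOn_angle_rpow ha h0 hpi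
  have hk : IntegrableOn (fun s => (sectorKernel a θ s).im) (Ioi 0) :=
    (integrableOn_sectorKernel ha hθ).im
  have hcontAngle : Continuous (fun u => angle θ u 1) :=
    continuous_iff_continuousAt.2 fun u => (angle_hasDerivAt h0 hpi u).continuousAt
  have hcont : ContinuousWithinAt (fun s : ℝ => s * angle θ (s ^ a) 1) (Ici 0) 0 := by
    refine ContinuousWithinAt.mul continuousWithinAt_id ?_
    refine hcontAngle.continuousAt.comp_continuousWithinAt ?_
    exact (Real.continuousAt_rpow_const 0 a (Or.inr (by linarith))).continuousWithinAt
  have hlim : Tendsto (fun s : ℝ => s * angle θ (s ^ a) 1) atTop (𝓝 0) := by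
    have := (tendsto_mul_inv_one_add_rpow ha).const_mul (3 * Real.pi)
    rw [mul_zero] at this
    refine squeeze_zero_norm' ?_ this
    filter_upwards [eventually_ge_atTop 0] with s hs
    rw [norm_mul, Real.norm_of_nonneg hs, Real.norm_of_nonneg (angle_mem_Ioo _ _ _).1.le]
    calc _ ≤ s * (3 * Real.pi / (1 + s ^ a)) := by
          gcongr; exact angle_le_div h0 hpi (Real.rpow_nonneg hs a)
      _ = _ := by ring
  have hderiv : ∀ s ∈ Ioi (0 : ℝ), HasDerivAt (fun s : ℝ => s * angle θ (s ^ a) 1)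
      (angle θ (s ^ a) 1 - a * (sectorKernel a θ s).im) s := by
    intro s hs
    have h1 := (angle_hasDerivAt h0 hpi (s ^ a)).comp s
      (Real.hasDerivAt_rpow_const (x := s) (p := a) (Or.inl (ne_of_gt hs)))
    refine ((hasDerivAt_id s).mul h1).congr_deriv ?_
    have e : s ^ a = s * s ^ (a - 1) := by
      rw [mul_comm, ← Real.rpow_add_one (ne_of_gt hs), sub_add_cancel]
    rw [sectorKernel_im]
    simp only [Function.comp, id]
    linear_combination (a * (Real.sin θ / ((s ^ a) ^ 2 + 2 * s ^ a * Real.cos θ + 1))) * e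
  have key := integral_Ioi_of_hasDerivAt_of_tendsto hcont hderiv (hi.sub (hk.const_mul a)) hlim
  rw [integral_sub hi (hk.const_mul a), integral_const_mul] at key
  have him : ∫ s in Ioi (0 : ℝ), (sectorKernel a θ s).im = (sectorIntegral a θ).im :=
    Complex.imCLM.integral_comp_comm (integrableOn_sectorKernel ha hθ)
  rw [him] at key
  linarith

-- As θ tends to π the angle becomes the argument of s^a - 1 approached from above: π for s < 1 and
-- 0 for s > 1. This determines the constant in the sine formula without evaluating the integral at
-- angle 0.
open MeasureTheory Set in
theorem tendsto_integral_angle_rpow {a : ℝ} (ha : 1 < a) :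
    Tendsto (fun θ => ∫ s in Ioi (0 : ℝ), angle θ (s ^ a) 1) (𝓝[<] Real.pi) (𝓝 Real.pi) := by
  have hpi := Real.pi_pos
  have hval : ∫ s in Ioi (0 : ℝ), (Ioc (0 : ℝ) 1).indicator (fun _ => Real.pi) s = Real.pi := by
    rw [setIntegral_indicator measurableSet_Ioc, inter_eq_right.2 Ioc_subset_Ioi_self]
    simp
  have hev : ∀ᶠ θ in 𝓝[<] Real.pi, 0 < θ ∧ θ < Real.pi := by
    filter_upwards [Ioo_mem_nhdsLT hpi] with θ hθ using hθ
  have hsin : Tendsto Real.sin (𝓝[<] Real.pi) (𝓝[>] 0) := by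
    refine tendsto_nhdsWithin_iff.2 ⟨?_, ?_⟩
    · rw [← Real.sin_pi]
      exact (Real.continuous_sin.tendsto _).mono_left nhdsWithin_le_nhds
    · filter_upwards [hev] with θ hθ using Real.sin_pos_of_pos_of_lt_pi hθ.1 hθ.2
  have hcos : ∀ u : ℝ, Tendsto (fun θ => u / 1 + Real.cos θ) (𝓝[<] Real.pi) (𝓝 (u - 1)) := by
    intro u
    have : Tendsto (fun θ => u / 1 + Real.cos θ) (𝓝 Real.pi) (𝓝 (u / 1 + Real.cos Real.pi)) :=
      Continuous.tendsto (by fun_prop) _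
    rw [Real.cos_pi, div_one, ← sub_eq_add_neg] at this
    simpa using this.mono_left nhdsWithin_le_nhds
  suffices h : Tendsto (fun θ => ∫ s in Ioi (0 : ℝ), angle θ (s ^ a) 1) (𝓝[<] Real.pi)
      (𝓝 (∫ s in Ioi (0 : ℝ), (Ioc (0 : ℝ) 1).indicator (fun _ => Real.pi) s)) by
    rwa [hval] at h
  refine tendsto_integral_filter_of_dominated_convergence
    (fun s => 3 * Real.pi * (1 + s ^ a)⁻¹) ?_ ?_
    ((integrableOn_inv_one_add_rpow ha).const_mul _) ?_
  · refine Eventually.of_forall fun θ => Measurable.aestronglyMeasurable ?_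
    unfold angle
    fun_prop
  · filter_upwards [hev] with θ hθ
    filter_upwards [ae_restrict_mem measurableSet_Ioi] with s hs
    rw [Real.norm_of_nonneg (angle_mem_Ioo _ _ _).1.le]
    exact angle_le_div hθ.1 hθ.2 (Real.rpow_nonneg (le_of_lt hs) a)
  · have hne : ∀ᵐ s ∂(volume.restrict (Ioi (0 : ℝ))), s ≠ 1 :=
      ae_restrict_of_ae (compl_mem_ae_iff.2 (measure_singleton (1 : ℝ)))
    filter_upwards [ae_restrict_mem measurableSet_Ioi, hne] with s hs hs1
    have hs0 : 0 < s := hs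
    unfold angle
    simp only [div_eq_mul_inv (_ + _ : ℝ)]
    rcases lt_or_gt_of_ne hs1 with h | h
    · have hu : s ^ a - 1 < 0 := by linarith [Real.rpow_lt_one hs0.le h (by linarith : 0 < a)]
      rw [indicator_of_mem (show s ∈ Ioc (0 : ℝ) 1 from ⟨hs0, h.le⟩)]
      have h1 := (tendsto_nhds_of_tendsto_nhdsWithin (Real.tendsto_arctan_atBot)).comp
        ((hcos (s ^ a)).neg_mul_atTop hu (tendsto_inv_nhdsGT_zero.comp hsin))
      have h2 := h1.const_sub (Real.pi / 2)
      rw [show Real.pi / 2 - -(Real.pi / 2) = Real.pi by ring] at h2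
      exact h2
    · have hu : 0 < s ^ a - 1 := by linarith [Real.one_lt_rpow h (by linarith : 0 < a)]
      rw [indicator_of_notMem (fun hm => absurd hm.2 (not_le.2 h))]
      have h1 := (tendsto_nhds_of_tendsto_nhdsWithin (Real.tendsto_arctan_atTop)).comp
        ((hcos (s ^ a)).pos_mul_atTop hu (tendsto_inv_nhdsGT_zero.comp hsin))
      have h2 := h1.const_sub (Real.pi / 2)
      rw [sub_self] at h2
      exact h2

/-! ### The exponent for which the integral equals π -/

/-- The exponent of the fixed point. -/
def fixedExponent (θ : ℝ) : ℝ := 1 + θ / Real.pi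

theorem one_lt_fixedExponent {θ : ℝ} (h0 : 0 < θ) : 1 < fixedExponent θ := by
  have := div_pos h0 Real.pi_pos
  unfold fixedExponent
  linarith

/-- Since θ/a and π/a add up to π, their sines agree, and the integral at angle θ equals its limit
at angle π. -/
theorem integral_angle_rpow {θ : ℝ} (h0 : 0 < θ) (hpi : θ < Real.pi) :
    ∫ s in Set.Ioi (0 : ℝ), angle θ (s ^ fixedExponent θ) 1 = Real.pi := by
  set a := fixedExponent θ with ha_def
  have ha : 1 < a := one_lt_fixedExponent h0
  have hp := Real.pi_pos
  have hformula : ∀ φ, 0 < φ → φ < Real.pi →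
      ∫ s in Set.Ioi (0 : ℝ), angle φ (s ^ a) 1
        = a * (sectorIntegral a 0).re * Real.sin (φ / a) := by
    intro φ h1 h2
    rw [integral_angle_rpow_eq_im ha h1 h2, sectorIntegral_eq ha ⟨by linarith, h2⟩, Complex.mul_im,
      sectorIntegral_zero_im, Complex.exp_ofReal_mul_I_im]
    ring
  have hlim := tendsto_integral_angle_rpow ha
  have hlim2 : Tendsto (fun φ => a * (sectorIntegral a 0).re * Real.sin (φ / a)) (𝓝[<] Real.pi)
      (𝓝 (a * (sectorIntegral a 0).re * Real.sin (Real.pi / a))) :=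
    (Continuous.tendsto (by fun_prop) _).mono_left nhdsWithin_le_nhds
  have hev : (fun φ => ∫ s in Set.Ioi (0 : ℝ), angle φ (s ^ a) 1) =ᶠ[𝓝[<] Real.pi]
      fun φ => a * (sectorIntegral a 0).re * Real.sin (φ / a) := by
    filter_upwards [Ioo_mem_nhdsLT hp] with φ hφ using hformula φ hφ.1 hφ.2
  have hval := tendsto_nhds_unique (hlim.congr' hev) hlim2
  have hsin : Real.sin (θ / a) = Real.sin (Real.pi / a) := by
    rw [← Real.sin_pi_sub]
    congr 1
    have : a * Real.pi = Real.pi + θ := by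
      rw [ha_def, fixedExponent]; field_simp
    field_simp
    linarith
  rw [hformula θ h0 hpi, hsin, ← hval]

/-! ### The operator in logarithmic coordinates -/

theorem rpow_div_eq_exp {s m a : ℝ} (hs : 0 < s) (hm : 0 < m) :
    (s / m) ^ a = Real.exp (a * Real.log s - a * Real.log m) := by
  rw [Real.rpow_def_of_pos (div_pos hs hm), Real.log_div hs.ne' hm.ne']
  ring_nf

open Set MeasureTheory in
theorem integral_angle_div_rpow {θ : ℝ} (h0 : 0 < θ) (hpi : θ < Real.pi) {m : ℝ} (hm : 0 < m) :
    IntegrableOn (fun s : ℝ => angle θ ((s / m) ^ fixedExponent θ) 1) (Ioi 0) ∧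
    ∫ s in Ioi (0 : ℝ), angle θ ((s / m) ^ fixedExponent θ) 1 = Real.pi * m := by
  have hm' := inv_pos.2 hm
  simp only [div_eq_inv_mul]
  constructor
  · refine (integrableOn_Ioi_comp_mul_left_iff (fun s => angle θ (s ^ fixedExponent θ) 1) 0
      hm').2 ?_
    rw [mul_zero]
    exact integrableOn_angle_rpow (one_lt_fixedExponent h0) h0 hpi
  · have h := integral_comp_mul_left_Ioi (fun s => angle θ (s ^ fixedExponent θ) 1) 0 hm'
    rw [mul_zero, integral_angle_rpow h0 hpi, inv_inv, smul_eq_mul, mul_comm m] at h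
    exact h

-- For a decreasing function, the sum from index 1 and the integral from 0 differ by at most the
-- value at 0. In the application that value is θ.
open Set MeasureTheory in
theorem tsum_add_one_bounds {f : ℝ → ℝ} (hanti : AntitoneOn f (Ici 0)) (hf : ∀ t, 0 ≤ f t)
    (hint : IntegrableOn f (Ioi 0)) :
    Summable (fun k : ℕ => f ((k + 1 : ℕ) : ℝ)) ∧
    (∫ s in Ioi (0 : ℝ), f s) - f 0 ≤ ∑' k : ℕ, f ((k + 1 : ℕ) : ℝ) ∧
    ∑' k : ℕ, f ((k + 1 : ℕ) : ℝ) ≤ ∫ s in Ioi (0 : ℝ), f s := by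
  have hsum := hanti.summable_of_integrableOn_Ioi_zero hint fun t _ => hf t
  have h1 := hanti.tsum_add_one_le_integral hint fun t _ => hf t
  have h2 := hanti.integral_le_tsum hsum fun t _ => hf t
  have h3 := hsum.tsum_eq_zero_add
  rw [Nat.cast_zero] at h3
  exact ⟨(summable_nat_add_iff (f := fun k : ℕ => f k) 1).2 hsum, by linarith, h1⟩

theorem tsum_angle_div_rpow {θ : ℝ} (h0 : 0 < θ) (hpi : θ < Real.pi) {m : ℝ} (hm : 0 < m) :
    Summable (fun k : ℕ => angle θ ((((k + 1 : ℕ) : ℝ) / m) ^ fixedExponent θ) 1) ∧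
    Real.pi * m - θ ≤ ∑' k : ℕ, angle θ ((((k + 1 : ℕ) : ℝ) / m) ^ fixedExponent θ) 1 ∧
    ∑' k : ℕ, angle θ ((((k + 1 : ℕ) : ℝ) / m) ^ fixedExponent θ) 1 ≤ Real.pi * m := by
  obtain ⟨hint, hval⟩ := integral_angle_div_rpow h0 hpi hm
  have ha : 1 < fixedExponent θ := one_lt_fixedExponent h0
  have hanti : AntitoneOn (fun s : ℝ => angle θ ((s / m) ^ fixedExponent θ) 1) (Set.Ici 0) := by
    intro s hs t ht hst
    apply angle_antitone h0 hpi
    have hsm : 0 ≤ s / m := div_nonneg hs hm.le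
    exact Real.rpow_le_rpow hsm (div_le_div_of_nonneg_right hst hm.le) (by linarith)
  obtain ⟨h1, h2, h3⟩ := tsum_add_one_bounds hanti (fun t => (angle_mem_Ioo _ _ _).1.le) hint
  have hz : angle θ ((0 / m) ^ fixedExponent θ) 1 = θ := by
    rw [zero_div, Real.zero_rpow (by linarith), angle_zero h0 hpi]
  rw [hval, hz] at h2
  rw [hval] at h3
  exact ⟨h1, h2, h3⟩

/-- The sums `φ_j` of the model sequence `(k ^ α)` at real positive indices. -/
theorem tsum_phase_powLog {θ : ℝ} (h0 : 0 < θ) (hpi : θ < Real.pi) {m : ℝ} (hm : 0 < m) :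
    Summable (fun k => phase θ (powLog (fixedExponent θ) k - fixedExponent θ * Real.log m)) ∧
    Real.pi * m - θ ≤ ∑' k, phase θ (powLog (fixedExponent θ) k - fixedExponent θ * Real.log m) ∧
    ∑' k, phase θ (powLog (fixedExponent θ) k - fixedExponent θ * Real.log m) ≤ Real.pi * m := by
  have hterm : ∀ k : ℕ, phase θ (powLog (fixedExponent θ) k - fixedExponent θ * Real.log m)
      = angle θ ((((k + 1 : ℕ) : ℝ) / m) ^ fixedExponent θ) 1 := by
    intro k
    rw [rpow_div_eq_exp (by positivity) hm, phase, powLog]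
    push_cast
    rfl
  simp only [hterm]
  exact tsum_angle_div_rpow h0 hpi hm

theorem summable_phase {θ : ℝ} (h0 : 0 < θ) (hpi : θ < Real.pi) {x : ℕ → ℝ}
    (hx : Summable fun k => Real.exp (-x k)) (c : ℝ) : Summable fun k => phase θ (x k - c) := by
  refine Summable.of_nonneg_of_le (fun k => (phase_pos _ _).le) (fun k => ?_)
    (hx.mul_left (3 * Real.pi * Real.exp c))
  refine (phase_le_exp h0 hpi _).trans_eq ?_
  rw [neg_sub, sub_eq_add_neg, Real.exp_add]
  ring

/-- `φ(X, Y) = Q` in logarithmic coordinates. -/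
def LogImage (θ : ℝ) (Q x y : ℕ → ℝ) : Prop :=
  ∀ j, HasSum (fun k => phase θ (x k - y j)) (Real.pi * Q j)

/-- The operator `T` in logarithmic coordinates. -/
def logT (θ : ℝ) (Q x : ℕ → ℝ) : ℕ → ℝ := logSeq (T θ Q fun k => Real.exp (x k))

theorem isImage_exp_iff {θ : ℝ} {Q x y : ℕ → ℝ} :
    IsImage θ Q (fun k => Real.exp (x k)) (fun k => Real.exp (y k)) ↔ LogImage θ Q x y := by
  have hp := Real.pi_pos
  simp only [IsImage, Real.exp_pos, implies_true, true_and, angle_exp_exp, LogImage]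
  refine forall_congr' fun j => ?_
  rw [← hasSum_mul_left_iff (one_div_ne_zero hp.ne') (f := fun k => phase θ (x k - y j))]
  rw [show 1 / Real.pi * (Real.pi * Q j) = Q j by field_simp]

theorem exp_logSeq {X : ℕ → ℝ} (hX : ∀ k, 0 < X k) : (fun k => Real.exp (logSeq X k)) = X :=
  funext fun k => Real.exp_log (hX k)

theorem logSeq_exp (x : ℕ → ℝ) : logSeq (fun k => Real.exp (x k)) = x :=
  funext fun k => Real.log_exp (x k)

theorem LogImage.logT_eq {θ : ℝ} (h0 : 0 < θ) (hpi : θ < Real.pi) {Q x y : ℕ → ℝ}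
    (h : LogImage θ Q x y) : logT θ Q x = y := by
  rw [logT, (isImage_exp_iff.2 h).T_eq h0 hpi, logSeq_exp]

theorem LogImage.T_eq {θ : ℝ} (h0 : 0 < θ) (hpi : θ < Real.pi) {Q X y : ℕ → ℝ}
    (hX : ∀ k, 0 < X k) (h : LogImage θ Q (logSeq X) y) :
    Defined θ Q X ∧ T θ Q X = fun k => Real.exp (y k) := by
  have h' := isImage_exp_iff.2 h
  rw [exp_logSeq hX] at h'
  exact ⟨⟨_, h'⟩, h'.T_eq h0 hpi⟩

theorem logImage_of_isFixed {θ : ℝ} (h0 : 0 < θ) (hpi : θ < Real.pi) {Q X : ℕ → ℝ}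
    (h : IsFixed θ Q X) : (∀ k, 0 < X k) ∧ LogImage θ Q (logSeq X) (logSeq X) := by
  obtain ⟨⟨Y, hY⟩, hT⟩ := h
  rw [hY.T_eq h0 hpi] at hT
  subst hT
  refine ⟨hY.1, ?_⟩
  rw [← isImage_exp_iff, exp_logSeq hY.1]
  exact hY

theorem LogImage.isFixed_exp {θ : ℝ} (h0 : 0 < θ) (hpi : θ < Real.pi) {Q x : ℕ → ℝ}
    (h : LogImage θ Q x x) : IsFixed θ Q fun k => Real.exp (x k) :=
  ⟨⟨_, isImage_exp_iff.2 h⟩, (isImage_exp_iff.2 h).T_eq h0 hpi⟩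

/-! ### Comparison, solvability and nonexpansiveness -/

/-- Comparison principle for the equations defining `T`. -/
theorem le_of_hasSum_phase {θ : ℝ} (h0 : 0 < θ) (hpi : θ < Real.pi) {x x' : ℕ → ℝ}
    {y y' A A' : ℝ} (hx : ∀ k, x k ≤ x' k) (h : HasSum (fun k => phase θ (x k - y)) A)
    (h' : HasSum (fun k => phase θ (x' k - y')) A') (hA : A ≤ A') : y ≤ y' := by
  by_contra! hlt
  have hl : ∀ k, phase θ (x' k - y') < phase θ (x k - y) := fun k =>
    phase_strictAnti h0 hpi (by linarith [hx k])
  exact absurd (hasSum_lt (fun k => (hl k).le) (hl 0) h' h) (not_lt.2 hA)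

/-- Each term increases with c, so on c < c₀ + 1 the series is dominated by its value at c₀ + 1. -/
theorem continuous_tsum_phase {θ : ℝ} (h0 : 0 < θ) (hpi : θ < Real.pi) {x : ℕ → ℝ}
    (hx : Summable fun k => Real.exp (-x k)) : Continuous fun c => ∑' k, phase θ (x k - c) := by
  refine continuous_iff_continuousAt.2 fun c => ?_
  have h : ContinuousOn (fun c => ∑' k, phase θ (x k - c)) (Set.Iio (c + 1)) := by
    refine continuousOn_tsum (u := fun k => phase θ (x k - (c + 1))) (fun k => ?_)
      (summable_phase h0 hpi hx _) fun k d hd => ?_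
    · exact ((phase_continuous h0 hpi).comp (by fun_prop)).continuousOn
    · rw [Real.norm_of_nonneg (phase_pos _ _).le]
      have hd' : d < c + 1 := hd
      exact phase_antitone h0 hpi (by linarith)
  exact h.continuousAt (Iio_mem_nhds (by linarith))

theorem exists_tsum_phase_eq {θ : ℝ} (h0 : 0 < θ) (hpi : θ < Real.pi) {x : ℕ → ℝ}
    (hx : Summable fun k => Real.exp (-x k)) {A : ℝ} (hA : 0 < A) :
    ∃ c, ∑' k, phase θ (x k - c) = A := by
  have hp := Real.pi_pos
  have hlow : ∃ c, ∑' k, phase θ (x k - c) ≤ A := by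
    have hS : 0 < ∑' k, Real.exp (-x k) := hx.tsum_pos (fun k => (Real.exp_pos _).le) 0
      (Real.exp_pos _)
    set S := ∑' k, Real.exp (-x k)
    -- Chosen so that the exponential bounds on the terms add up to exactly A.
    refine ⟨Real.log (A / (3 * Real.pi * S)), ?_⟩
    have hle : ∀ k, phase θ (x k - Real.log (A / (3 * Real.pi * S)))
        ≤ (A / S) * Real.exp (-x k) := by
      intro k
      refine (phase_le_exp h0 hpi _).trans_eq ?_
      rw [neg_sub, sub_eq_add_neg, Real.exp_add, Real.exp_log (by positivity)]
      field_simp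
    refine ((summable_phase h0 hpi hx _).tsum_le_tsum hle (hx.mul_left _)).trans_eq ?_
    rw [tsum_mul_left]
    exact div_mul_cancel₀ A hS.ne'
  have hhigh : ∃ c, A ≤ ∑' k, phase θ (x k - c) := by
    obtain ⟨N, hN⟩ := exists_nat_ge (A / (θ / 2))
    -- This c exceeds each of the first N terms of x, so each contributes at least θ/2.
    refine ⟨∑ k ∈ Finset.range N, |x k|, ?_⟩
    refine le_trans ?_ ((summable_phase h0 hpi hx _).sum_le_tsum (Finset.range N)
      fun k _ => (phase_pos _ _).le)
    calc A ≤ N * (θ / 2) := by rwa [div_le_iff₀ (by linarith)] at hN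
      _ = ∑ k ∈ Finset.range N, θ / 2 := by simp
      _ ≤ _ := by
        refine Finset.sum_le_sum fun k hk => ?_
        rw [← phase_zero h0 hpi]
        apply phase_antitone h0 hpi
        have := Finset.single_le_sum (f := fun k => |x k|) (fun i _ => abs_nonneg _) hk
        linarith [le_abs_self (x k)]
  obtain ⟨c, hc⟩ := hlow
  obtain ⟨d, hd⟩ := hhigh
  exact mem_range_of_exists_le_of_exists_ge (continuous_tsum_phase h0 hpi hx) ⟨c, hc⟩ ⟨d, hd⟩

theorem logImage_logT {θ : ℝ} (h0 : 0 < θ) (hpi : θ < Real.pi) {Q x : ℕ → ℝ}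
    (hQ : ∀ j, 0 < Q j) (hx : Summable fun k => Real.exp (-x k)) : LogImage θ Q x (logT θ Q x) := by
  choose y hy using fun j => exists_tsum_phase_eq h0 hpi hx (mul_pos Real.pi_pos (hQ j))
  have h : LogImage θ Q x y := fun j => by
    rw [← hy j]
    exact (summable_phase h0 hpi hx _).hasSum
  rwa [h.logT_eq h0 hpi]

theorem LogImage.mono {θ : ℝ} (h0 : 0 < θ) (hpi : θ < Real.pi) {Q x x' y y' : ℕ → ℝ}
    (h : LogImage θ Q x y) (h' : LogImage θ Q x' y') (hx : ∀ k, x k ≤ x' k) (j : ℕ) :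
    y j ≤ y' j :=
  le_of_hasSum_phase h0 hpi hx (h j) (h' j) le_rfl

theorem LogImage.add_const {θ : ℝ} {Q x y : ℕ → ℝ} (h : LogImage θ Q x y) (c : ℝ) :
    LogImage θ Q (fun k => x k + c) (fun k => y k + c) := fun j => by
  simpa using h j

/-- Bounded distance. -/
def BddDist (x y : ℕ → ℝ) : Prop := ∃ D, ∀ k, |x k - y k| ≤ D

theorem summable_exp_neg_powLog {a : ℝ} (ha : 1 < a) :
    Summable fun k => Real.exp (-powLog a k) := by
  have h := (summable_nat_add_iff 1).2 (Real.summable_nat_rpow.2 (neg_lt_neg ha))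
  refine h.congr fun k => ?_
  have : (0 : ℝ) < (k : ℝ) + 1 := by positivity
  push_cast
  rw [Real.rpow_def_of_pos this, powLog]
  ring_nf

theorem BddDist.summable_exp_neg {x : ℕ → ℝ} {a : ℝ} (ha : 1 < a) (h : BddDist x (powLog a)) :
    Summable fun k => Real.exp (-x k) := by
  obtain ⟨D, hD⟩ := h
  refine Summable.of_nonneg_of_le (fun k => (Real.exp_pos _).le) (fun k => ?_)
    ((summable_exp_neg_powLog ha).mul_left (Real.exp D))
  rw [← Real.exp_add]
  apply Real.exp_le_exp.2
  linarith [neg_abs_le (x k - powLog a k), hD k]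

theorem BddDist.trans {x y z : ℕ → ℝ} (h : BddDist x y) (h' : BddDist y z) : BddDist x z := by
  obtain ⟨D, hD⟩ := h
  obtain ⟨D', hD'⟩ := h'
  exact ⟨D + D', fun k => (abs_sub_le _ (y k) _).trans (add_le_add (hD k) (hD' k))⟩

/-- Monotonicity applied to x' - D ≤ x ≤ x' + D, together with equivariance under constants. -/
theorem LogImage.abs_sub_le {θ : ℝ} (h0 : 0 < θ) (hpi : θ < Real.pi) {Q x x' y y' : ℕ → ℝ}
    (h : LogImage θ Q x y) (h' : LogImage θ Q x' y') {D : ℝ} (hx : ∀ k, |x k - x' k| ≤ D) (j : ℕ) :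
    |y j - y' j| ≤ D := by
  have h1 := (h.mono h0 hpi (h'.add_const D) (fun k => by linarith [(abs_le.1 (hx k)).2])) j
  have h2 := ((h'.add_const (-D)).mono h0 hpi h (fun k => by linarith [(abs_le.1 (hx k)).1])) j
  rw [abs_le]
  constructor <;> linarith

/-- The limit of a pointwise convergent orbit is a fixed point. -/
theorem logImage_of_tendsto {θ : ℝ} (h0 : 0 < θ) (hpi : θ < Real.pi) {Q l h q : ℕ → ℝ}
    {u : ℕ → ℕ → ℝ} (hu : ∀ n, LogImage θ Q (u n) (u (n + 1)))
    (hl : Summable fun k => Real.exp (-l k)) (hlu : ∀ n k, l k ≤ u n k) (huh : ∀ n k, u n k ≤ h k)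
    (hq : ∀ k, Tendsto (fun n => u n k) atTop (𝓝 (q k))) : LogImage θ Q q q := by
  intro j
  have hlq : ∀ k, l k ≤ q k := fun k => ge_of_tendsto' (hq k) fun n => hlu n k
  have hsum : Summable fun k => phase θ (q k - q j) := by
    refine summable_phase h0 hpi (Summable.of_nonneg_of_le (fun k => (Real.exp_pos _).le)
      (fun k => Real.exp_le_exp.2 (neg_le_neg (hlq k))) hl) _
  have ht : Tendsto (fun n => ∑' k, phase θ (u n k - u (n + 1) j)) atTop
      (𝓝 (∑' k, phase θ (q k - q j))) := by
    -- The terms are dominated by those with u_n replaced by its lower bound l and u_{n+1}(j) by its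
    -- upper bound h(j).
    refine tendsto_tsum_of_dominated_convergence (summable_phase h0 hpi hl (h j)) (fun k => ?_) ?_
    · exact ((phase_continuous h0 hpi).tendsto _).comp
        ((hq k).sub ((hq j).comp (tendsto_add_atTop_nat 1)))
    · refine Eventually.of_forall fun n k => ?_
      rw [Real.norm_of_nonneg (phase_pos _ _).le]
      exact phase_antitone h0 hpi (by linarith [hlu n k, huh (n + 1) j])
  have hc : (fun n => ∑' k, phase θ (u n k - u (n + 1) j)) = fun _ => Real.pi * Q j :=
    funext fun n => (hu n j).tsum_eq
  rw [hc] at ht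
  rw [tendsto_nhds_unique tendsto_const_nhds ht]
  exact hsum.hasSum

/-! ### Uniqueness of fixed points -/

/-- Maximum principle for two fixed points. -/
theorem not_isMax_sub {θ : ℝ} (h0 : 0 < θ) (hpi : θ < Real.pi) {Q q q' : ℕ → ℝ}
    (hq : LogImage θ Q q q) (hq' : LogImage θ Q q' q') {i j : ℕ}
    (hmax : ∀ k, q k - q' k ≤ q j - q' j) (hlt : q i - q' i < q j - q' j) : False := by
  -- At a maximum j of q - q', every q_k - q_j is at most q'_k - q'_j, strictly for k = i. The
  -- phases then give strictly ordered sums, although both equal π Q_j.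
  refine lt_irrefl _ (hasSum_lt (i := i) (fun k => ?_) ?_ (hq' j) (hq j))
  · exact phase_antitone h0 hpi (by linarith [hmax k])
  · exact phase_strictAnti h0 hpi (by linarith)

/-- A sequence that is eventually below one of its terms has a maximum. -/
theorem exists_isMax_of_eventually_le {d : ℕ → ℝ} {i : ℕ} (h : ∀ᶠ k in atTop, d k < d i) :
    ∃ j, (∀ k, d k ≤ d j) ∧ ∃ k, d k < d j := by
  obtain ⟨N, hN⟩ := eventually_atTop.1 h
  have hiN : i < N := by
    by_contra! hcon
    exact lt_irrefl _ (hN i hcon)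
  obtain ⟨j, -, hj⟩ := Finset.exists_max_image (Finset.range N) d ⟨i, Finset.mem_range.2 hiN⟩
  have hij := hj i (Finset.mem_range.2 hiN)
  refine ⟨j, fun k => ?_, N, (hN N le_rfl).trans_le hij⟩
  rcases lt_or_ge k N with hk | hk
  · exact hj k (Finset.mem_range.2 hk)
  · exact (hN k hk).le.trans hij

/-- A positive value of q - q' would force an attained, nonconstant maximum, because the difference
tends to 0. -/
theorem le_of_tendsto_sub_zero {θ : ℝ} (h0 : 0 < θ) (hpi : θ < Real.pi) {Q q q' : ℕ → ℝ}
    (hq : LogImage θ Q q q) (hq' : LogImage θ Q q' q')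
    (hd : Tendsto (fun k => q k - q' k) atTop (𝓝 0)) (i : ℕ) : q i ≤ q' i := by
  by_contra! hlt
  obtain ⟨j, hj, k, hk⟩ := exists_isMax_of_eventually_le (d := fun k => q k - q' k) (i := i)
    (hd.eventually (gt_mem_nhds (sub_pos.2 hlt)))
  exact not_isMax_sub h0 hpi hq hq' hj hk

theorem eq_of_tendsto_sub_zero {θ : ℝ} (h0 : 0 < θ) (hpi : θ < Real.pi) {Q q q' : ℕ → ℝ}
    (hq : LogImage θ Q q q) (hq' : LogImage θ Q q' q')
    (hd : Tendsto (fun k => q k - q' k) atTop (𝓝 0)) : q = q' := by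
  funext i
  refine le_antisymm (le_of_tendsto_sub_zero h0 hpi hq hq' hd i)
    (le_of_tendsto_sub_zero h0 hpi hq' hq ?_ i)
  simpa using hd.neg

/-- A difference tending to -∞ attains a maximum and is not constant. This excludes fixed points
with different exponents. -/
theorem false_of_tendsto_sub_atBot {θ : ℝ} (h0 : 0 < θ) (hpi : θ < Real.pi) {Q q q' : ℕ → ℝ}
    (hq : LogImage θ Q q q) (hq' : LogImage θ Q q' q')
    (hd : Tendsto (fun k => q k - q' k) atTop atBot) : False := by
  obtain ⟨j, hj, k, hk⟩ := exists_isMax_of_eventually_le (d := fun k => q k - q' k) (i := 0)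
    (hd.eventually (eventually_lt_atBot _))
  exact not_isMax_sub h0 hpi hq hq' hj hk

/-! ### Weighted sequence spaces -/

theorem exists_forall_le_of_eventually_le {v w : ℕ → ℝ} (hw : ∀ k, 0 < w k) {C : ℝ}
    (h : ∀ᶠ k in atTop, |v k| ≤ C * w k) : ∃ C', 0 < C' ∧ ∀ k, |v k| ≤ C' * w k := by
  obtain ⟨N, hN⟩ := eventually_atTop.1 h
  have hs : 0 ≤ ∑ k ∈ Finset.range N, |v k| / w k :=
    Finset.sum_nonneg fun k _ => div_nonneg (abs_nonneg _) (hw k).le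
  refine ⟨|C| + 1 + ∑ k ∈ Finset.range N, |v k| / w k, by positivity, fun k => ?_⟩
  rcases lt_or_ge k N with hk | hk
  · have h1 := Finset.single_le_sum (f := fun k => |v k| / w k)
      (fun i _ => div_nonneg (abs_nonneg _) (hw i).le) (Finset.mem_range.2 hk)
    rw [← div_le_iff₀ (hw k)]
    linarith [abs_nonneg C]
  · refine (hN k hk).trans (mul_le_mul_of_nonneg_right ?_ (hw k).le)
    linarith [le_abs_self C]

theorem rpow_weight_pos (ε : ℝ) (k : ℕ) : 0 < ((k : ℝ) + 1) ^ ε :=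
  Real.rpow_pos_of_pos (by positivity) ε

theorem mem_smallU_iff {ε : ℝ} {v : ℕ → ℝ} :
    v ∈ smallU ε ↔ ∃ C, 0 < C ∧ ∀ k : ℕ, |v k| ≤ C * ((k : ℝ) + 1) ^ (-ε) := by
  constructor
  · intro h
    obtain ⟨C, hC⟩ := Asymptotics.isBigO_iff.1 (show v =O[atTop] _ from h)
    refine exists_forall_le_of_eventually_le (C := C) (rpow_weight_pos (-ε)) ?_
    filter_upwards [hC] with k hk
    rwa [Real.norm_of_nonneg (rpow_weight_pos (-ε) k).le] at hk
  · rintro ⟨C, -, hC⟩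
    refine Asymptotics.isBigO_iff.2 ⟨C, Eventually.of_forall fun k => ?_⟩
    rw [Real.norm_of_nonneg (rpow_weight_pos (-ε) k).le]
    exact hC k

theorem mem_smallU0_zero_iff {v : ℕ → ℝ} : v ∈ smallU0 0 ↔ Tendsto v atTop (𝓝 0) := by
  simp only [smallU0, neg_zero, Real.rpow_zero, Set.mem_ofPred_eq]
  exact Asymptotics.isLittleO_one_iff ℝ

theorem tendsto_rpow_weight {ε : ℝ} (hε : 0 < ε) :
    Tendsto (fun k : ℕ => ((k : ℝ) + 1) ^ (-ε)) atTop (𝓝 0) :=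
  (tendsto_rpow_neg_atTop hε).comp
    (tendsto_atTop_add_const_right atTop (1 : ℝ) tendsto_natCast_atTop_atTop)

theorem tendsto_zero_of_le_rpow_weight {ε C : ℝ} (hε : 0 < ε) {v : ℕ → ℝ}
    (h : ∀ k : ℕ, |v k| ≤ C * ((k : ℝ) + 1) ^ (-ε)) : Tendsto v atTop (𝓝 0) := by
  have := (tendsto_rpow_weight hε).const_mul C
  rw [mul_zero] at this
  exact squeeze_zero_norm h this

theorem bddDist_of_tendsto {x y : ℕ → ℝ} (h : Tendsto (fun k => x k - y k) atTop (𝓝 0)) :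
    BddDist x y := by
  obtain ⟨C, hC⟩ := h.norm.bddAbove_range
  exact ⟨C, fun k => hC ⟨k, rfl⟩⟩

/-! ### Super- and subsolutions -/

/-- The standing assumptions on the angle and on the sequence `Q`. -/
structure Admissible (θ : ℝ) (Q : ℕ → ℝ) : Prop where
  pos : 0 < θ
  lt_pi : θ < Real.pi
  bdd : ∃ K : ℝ, ∀ k : ℕ, |Q k - ((k : ℝ) + 1)| ≤ K
  low : ∀ k : ℕ, (((k : ℝ) + 1) - 1 / 2) * (θ / Real.pi) < Q k

theorem Admissible.Q_pos {θ : ℝ} {Q : ℕ → ℝ} (A : Admissible θ Q) (k : ℕ) : 0 < Q k := by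
  refine lt_of_le_of_lt (mul_nonneg ?_ (div_pos A.pos Real.pi_pos).le) (A.low k)
  have : (0 : ℝ) ≤ k := by positivity
  linarith

/-- The sequence `(α ln (k + N))`. -/
def upperShift (θ : ℝ) (N k : ℕ) : ℝ := powLog (fixedExponent θ) (k + N)

/-- The sequence `(α ln (k - N))`, preceded by `N` terms that are very negative and far apart. -/
def lowerShift (θ : ℝ) (N : ℕ) (M : ℝ) (k : ℕ) : ℝ :=
  if k < N then -(M * ((N : ℝ) - k)) else powLog (fixedExponent θ) (k - N)

theorem powLog_mono {a : ℝ} (ha : 0 < a) : Monotone (powLog a) := by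
  intro i j hij
  have : (i : ℝ) ≤ j := by exact_mod_cast hij
  unfold powLog
  gcongr

theorem fixedExponent_pos {θ : ℝ} (h0 : 0 < θ) : 0 < fixedExponent θ :=
  one_pos.trans (one_lt_fixedExponent h0)

theorem powLog_le_upperShift {θ : ℝ} (h0 : 0 < θ) (N k : ℕ) :
    powLog (fixedExponent θ) k ≤ upperShift θ N k :=
  powLog_mono (fixedExponent_pos h0) (Nat.le_add_right k N)

theorem powLog_nonneg {a : ℝ} (ha : 0 < a) (k : ℕ) : 0 ≤ powLog a k := by
  have := powLog_mono ha (Nat.zero_le k)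
  simpa [powLog] using this

theorem lowerShift_le_powLog {θ : ℝ} (h0 : 0 < θ) (N : ℕ) {M : ℝ} (hM : 0 ≤ M) (k : ℕ) :
    lowerShift θ N M k ≤ powLog (fixedExponent θ) k := by
  have ha := fixedExponent_pos h0
  unfold lowerShift
  split_ifs with h
  · have : (k : ℝ) ≤ N := by exact_mod_cast h.le
    have h1 := powLog_nonneg ha k
    have h2 : 0 ≤ M * ((N : ℝ) - k) := mul_nonneg hM (by linarith)
    linarith
  · exact powLog_mono ha (Nat.sub_le k N)

theorem log_sub_log_le {s t : ℝ} (hs : 0 < s) (ht : 0 < t) :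
    Real.log t - Real.log s ≤ (t - s) / s := by
  rw [← Real.log_div ht.ne' hs.ne']
  refine (Real.log_le_sub_one_of_pos (div_pos ht hs)).trans_eq ?_
  field_simp

theorem abs_upperShift_sub_le {θ : ℝ} (h0 : 0 < θ) (N : ℕ) :
    ∃ C, 0 < C ∧ ∀ k : ℕ,
      |upperShift θ N k - powLog (fixedExponent θ) k| ≤ C * ((k : ℝ) + 1) ^ (-1 : ℝ) := by
  have ha := fixedExponent_pos h0
  refine exists_forall_le_of_eventually_le (C := fixedExponent θ * N) (rpow_weight_pos _)
    (Eventually.of_forall fun k => ?_)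
  have hk : (0 : ℝ) < (k : ℝ) + 1 := by positivity
  rw [abs_of_nonneg (sub_nonneg.2 (powLog_le_upperShift h0 N k)), upperShift, powLog, powLog,
    ← mul_sub, mul_assoc, Real.rpow_neg_one]
  have h := log_sub_log_le hk (by positivity : (0 : ℝ) < ((k + N : ℕ) : ℝ) + 1)
  refine mul_le_mul_of_nonneg_left (h.trans_eq ?_) ha.le
  push_cast
  ring

theorem abs_lowerShift_sub_le {θ : ℝ} (h0 : 0 < θ) (N : ℕ) {M : ℝ} (hM : 0 ≤ M) :
    ∃ C, 0 < C ∧ ∀ k : ℕ,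
      |lowerShift θ N M k - powLog (fixedExponent θ) k| ≤ C * ((k : ℝ) + 1) ^ (-1 : ℝ) := by
  have ha := fixedExponent_pos h0
  refine exists_forall_le_of_eventually_le (C := fixedExponent θ * (N * (N + 1)))
    (rpow_weight_pos _) ?_
  filter_upwards [eventually_ge_atTop N] with k hkN
  have hk : (0 : ℝ) < (k : ℝ) + 1 := by positivity
  rw [abs_sub_comm, abs_of_nonneg (sub_nonneg.2 (lowerShift_le_powLog h0 N hM k)), lowerShift,
    if_neg (not_lt.2 hkN), powLog, powLog, ← mul_sub, mul_assoc, Real.rpow_neg_one]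
  have hcast : ((k - N : ℕ) : ℝ) = (k : ℝ) - N := Nat.cast_sub hkN
  have hk' : (N : ℝ) ≤ k := by exact_mod_cast hkN
  have hpos : (0 : ℝ) < ((k - N : ℕ) : ℝ) + 1 := by positivity
  have h := log_sub_log_le hpos hk
  refine mul_le_mul_of_nonneg_left (h.trans ?_) ha.le
  rw [← div_eq_mul_inv, div_le_div_iff₀ hpos hk, hcast]
  have hN0 : (0 : ℝ) ≤ N := by positivity
  nlinarith [mul_nonneg hN0 (mul_nonneg hN0 (sub_nonneg.2 hk'))]

/-- The sum at j is the model sum at m = j + N + 1 without its first N terms, hence at least π(j + N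
+ 1) - θ - Nθ. The surplus N(π - θ) absorbs the bounded error of Q. -/
theorem Admissible.upperShift_super {θ : ℝ} {Q : ℕ → ℝ} (A : Admissible θ Q) :
    ∀ᶠ N in atTop, ∀ y, LogImage θ Q (upperShift θ N) y → ∀ j, y j ≤ upperShift θ N j := by
  obtain ⟨K, hK⟩ := A.bdd
  have h0 := A.pos
  have hpi := A.lt_pi
  have hN : ∀ᶠ N : ℕ in atTop, θ + Real.pi * K ≤ N * (Real.pi - θ) := by
    have := (tendsto_natCast_atTop_atTop (R := ℝ)).atTop_mul_const (sub_pos.2 hpi)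
    exact this.eventually_ge_atTop _
  filter_upwards [hN] with N hN y hy j
  obtain ⟨hs, hlow, -⟩ := tsum_phase_powLog h0 hpi (by positivity : (0 : ℝ) < ((j + N : ℕ) : ℝ) + 1)
  set f := fun k => phase θ (powLog (fixedExponent θ) k
    - fixedExponent θ * Real.log (((j + N : ℕ) : ℝ) + 1)) with hf
  have hs' : Summable fun k => f (k + N) := (summable_nat_add_iff N).2 hs
  have hsplit := hs.sum_add_tsum_nat_add N
  have hfin : ∑ k ∈ Finset.range N, f k ≤ N * θ := by
    calc _ ≤ ∑ k ∈ Finset.range N, θ := Finset.sum_le_sum fun k _ => phase_le h0 hpi _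
      _ = _ := by simp
  refine le_of_hasSum_phase h0 hpi (fun k => le_rfl) (hy j)
    (show HasSum (fun k => phase θ (upperShift θ N k - upperShift θ N j)) _ from hs'.hasSum) ?_
  have hQj := (abs_le.1 (hK j)).2
  have : Real.pi * Q j ≤ Real.pi * (K + (j + 1)) :=
    mul_le_mul_of_nonneg_left (by linarith) Real.pi_pos.le
  push_cast at hlow
  nlinarith

/-- For j ≥ N the prepended terms add at most Nθ, while the model sum drops by πN. For j < N, as M
grows, the terms before j contribute at most θ each, the diagonal term θ/2 and all later ones almost
nothing; the total is just above (j + 1/2)θ at worst, which is below π Q_j by hypothesis. -/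
theorem Admissible.lowerShift_sub {θ : ℝ} {Q : ℕ → ℝ} (A : Admissible θ Q) :
    ∀ᶠ N in atTop, ∀ᶠ M in atTop, ∀ y, LogImage θ Q (lowerShift θ N M) y →
      ∀ j, lowerShift θ N M j ≤ y j := by
  obtain ⟨K, hK⟩ := A.bdd
  have h0 := A.pos
  have hpi := A.lt_pi
  have hp := Real.pi_pos
  have hN : ∀ᶠ N : ℕ in atTop, Real.pi * K ≤ N * (Real.pi - θ) := by
    have := (tendsto_natCast_atTop_atTop (R := ℝ)).atTop_mul_const (sub_pos.2 hpi)
    exact this.eventually_ge_atTop _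
  filter_upwards [hN] with N hN
  set a := fixedExponent θ
  have ha : 1 < a := one_lt_fixedExponent h0
  have hsexp := summable_exp_neg_powLog ha
  set S := ∑' k, Real.exp (-powLog a k)
  have hsmall : ∀ᶠ M in atTop, ∀ j ∈ Finset.range N,
      ((j : ℝ) + 1 - 1 / 2) * θ + 3 * Real.pi * Real.exp (-M) * (N + S) ≤ Real.pi * Q j := by
    rw [Filter.eventually_all_finset]
    intro j _
    have hlim : Tendsto (fun M => ((j : ℝ) + 1 - 1 / 2) * θ
        + 3 * Real.pi * Real.exp (-M) * (N + S)) atTop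
        (𝓝 (((j : ℝ) + 1 - 1 / 2) * θ + 3 * Real.pi * 0 * (N + S))) :=
      ((Real.tendsto_exp_neg_atTop_nhds_zero.const_mul _).mul_const _).const_add _
    have hlt : ((j : ℝ) + 1 - 1 / 2) * θ + 3 * Real.pi * 0 * (N + S) < Real.pi * Q j := by
      have := mul_lt_mul_of_pos_left (A.low j) hp
      calc _ = Real.pi * (((j : ℝ) + 1 - 1 / 2) * (θ / Real.pi)) := by field_simp; ring
        _ < _ := this
    filter_upwards [hlim.eventually (gt_mem_nhds hlt)] with M hM using hM.le
  filter_upwards [hsmall, eventually_ge_atTop 0] with M hM hM0 y hy j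
  have hbelow : ∀ k : ℕ, lowerShift θ N M (k + N) = powLog a k := fun k => by
    simp [lowerShift, a]
  have hsum : ∀ c, Summable fun k => phase θ (lowerShift θ N M k - c) := fun c => by
    rw [← summable_nat_add_iff N]
    simp only [hbelow]
    exact summable_phase h0 hpi hsexp c
  refine le_of_hasSum_phase h0 hpi (fun k => le_rfl) (hsum _).hasSum (hy j) ?_
  rw [← (hsum _).sum_add_tsum_nat_add N]
  simp only [hbelow]
  rcases lt_or_ge j N with hj | hj
  · refine le_trans ?_ (hM j (Finset.mem_range.2 hj))
    have hlj : lowerShift θ N M j = -(M * ((N : ℝ) - j)) := if_pos hj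
    have hjN : (j : ℝ) + 1 ≤ N := by exact_mod_cast hj
    have htail : ∑' k, phase θ (powLog a k - lowerShift θ N M j)
        ≤ 3 * Real.pi * Real.exp (-M) * S := by
      rw [← tsum_mul_left]
      refine (summable_phase h0 hpi hsexp _).tsum_le_tsum (fun k => ?_) (hsexp.mul_left _)
      refine (phase_le_exp h0 hpi _).trans ?_
      rw [mul_assoc _ (Real.exp (-M)), ← Real.exp_add]
      gcongr
      rw [hlj]
      nlinarith
    have hhead : ∑ k ∈ Finset.range N, phase θ (lowerShift θ N M k - lowerShift θ N M j)
        ≤ ((j : ℝ) + 1 - 1 / 2) * θ + 3 * Real.pi * Real.exp (-M) * N := by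
      obtain ⟨r, hr⟩ := Nat.exists_eq_add_of_le (Nat.succ_le_of_lt hj)
      have hlast : ∀ i ∈ Finset.range r,
          phase θ (lowerShift θ N M (j.succ + i) - lowerShift θ N M j)
            ≤ 3 * Real.pi * Real.exp (-M) := by
        intro i hi
        have hiN : j.succ + i < N := by have := Finset.mem_range.1 hi; omega
        refine (phase_le_exp h0 hpi _).trans ?_
        gcongr
        rw [hlj, lowerShift, if_pos hiN]
        push_cast
        have : (0 : ℝ) ≤ i := by positivity
        nlinarith
      have hfirst : ∑ k ∈ Finset.range j, phase θ (lowerShift θ N M k - lowerShift θ N M j)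
          ≤ j * θ := by
        calc _ ≤ ∑ k ∈ Finset.range j, θ := Finset.sum_le_sum fun k _ => phase_le h0 hpi _
          _ = _ := by simp
      have hrN : (r : ℝ) ≤ N := by exact_mod_cast (by omega : r ≤ N)
      have hsplit : ∑ k ∈ Finset.range N, phase θ (lowerShift θ N M k - lowerShift θ N M j)
          = ∑ k ∈ Finset.range j, phase θ (lowerShift θ N M k - lowerShift θ N M j)
            + phase θ (lowerShift θ N M j - lowerShift θ N M j)
            + ∑ i ∈ Finset.range r, phase θ (lowerShift θ N M (j.succ + i)
              - lowerShift θ N M j) := by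
        rw [show Finset.range N = Finset.range (j.succ + r) by rw [← hr], Finset.sum_range_add,
          Finset.sum_range_succ]
      have hr2 : ∑ i ∈ Finset.range r, phase θ (lowerShift θ N M (j.succ + i)
          - lowerShift θ N M j) ≤ 3 * Real.pi * Real.exp (-M) * N := by
        calc _ ≤ ∑ i ∈ Finset.range r, 3 * Real.pi * Real.exp (-M) := Finset.sum_le_sum hlast
          _ = r * (3 * Real.pi * Real.exp (-M)) := by simp
          _ ≤ N * (3 * Real.pi * Real.exp (-M)) := by gcongr
          _ = _ := by ring
      rw [hsplit, sub_self, phase_zero h0 hpi]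
      linarith
    linarith
  · have hlj : lowerShift θ N M j = a * Real.log (((j - N : ℕ) : ℝ) + 1) := by
      rw [lowerShift, if_neg (not_lt.2 hj), powLog]
    obtain ⟨-, -, hup⟩ := tsum_phase_powLog h0 hpi
      (by positivity : (0 : ℝ) < ((j - N : ℕ) : ℝ) + 1)
    have hhead : ∑ k ∈ Finset.range N, phase θ (lowerShift θ N M k - lowerShift θ N M j)
        ≤ N * θ := by
      calc _ ≤ ∑ k ∈ Finset.range N, θ := Finset.sum_le_sum fun k _ => phase_le h0 hpi _
        _ = _ := by simp
    have hQj := (abs_le.1 (hK j)).1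
    have : Real.pi * (-K + (j + 1)) ≤ Real.pi * Q j :=
      mul_le_mul_of_nonneg_left (by linarith) hp.le
    rw [hlj] at hhead ⊢
    rw [Nat.cast_sub hj] at *
    nlinarith

/-! ### Orbits -/

theorem Admissible.logImage {θ : ℝ} {Q x : ℕ → ℝ} (A : Admissible θ Q)
    (hx : BddDist x (powLog (fixedExponent θ))) : LogImage θ Q x (logT θ Q x) :=
  logImage_logT A.pos A.lt_pi A.Q_pos (hx.summable_exp_neg (one_lt_fixedExponent A.pos))

theorem Admissible.logT_mono {θ : ℝ} {Q x x' : ℕ → ℝ} (A : Admissible θ Q)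
    (hx : BddDist x (powLog (fixedExponent θ))) (hx' : BddDist x' (powLog (fixedExponent θ)))
    (h : ∀ k, x k ≤ x' k) (k : ℕ) : logT θ Q x k ≤ logT θ Q x' k :=
  (A.logImage hx).mono A.pos A.lt_pi (A.logImage hx') h k

theorem tendsto_upperShift_sub {θ : ℝ} (h0 : 0 < θ) (N : ℕ) :
    Tendsto (fun k => upperShift θ N k - powLog (fixedExponent θ) k) atTop (𝓝 0) := by
  obtain ⟨C, -, hC⟩ := abs_upperShift_sub_le h0 N
  exact tendsto_zero_of_le_rpow_weight one_pos hC

theorem tendsto_lowerShift_sub {θ : ℝ} (h0 : 0 < θ) (N : ℕ) {M : ℝ} (hM : 0 ≤ M) :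
    Tendsto (fun k => lowerShift θ N M k - powLog (fixedExponent θ) k) atTop (𝓝 0) := by
  obtain ⟨C, -, hC⟩ := abs_lowerShift_sub_le h0 N hM
  exact tendsto_zero_of_le_rpow_weight one_pos hC

/-- A sub- and a supersolution that enclose, up to `δ`, a sequence close to `(α ln k)`. -/
theorem Admissible.exists_enclosure {θ : ℝ} {Q x : ℕ → ℝ} (A : Admissible θ Q)
    (hx : Tendsto (fun k => x k - powLog (fixedExponent θ) k) atTop (𝓝 0)) {δ : ℝ} (hδ : 0 < δ) :
    ∃ N M, 0 ≤ M ∧ (∀ k, x k ≤ upperShift θ N k + δ) ∧ (∀ k, lowerShift θ N M k - δ ≤ x k) ∧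
      (∀ k, logT θ Q (upperShift θ N) k ≤ upperShift θ N k) ∧
      (∀ k, lowerShift θ N M k ≤ logT θ Q (lowerShift θ N M) k) := by
  have h0 := A.pos
  have ha := fixedExponent_pos h0
  obtain ⟨K, hK⟩ := eventually_atTop.1 (hx.eventually (Metric.ball_mem_nhds 0 hδ))
  have hK' : ∀ k, K ≤ k → |x k - powLog (fixedExponent θ) k| < δ := fun k hk => by
    simpa [Real.dist_eq] using hK k hk
  have hlim : Tendsto (powLog (fixedExponent θ)) atTop atTop := by
    refine (Real.tendsto_log_atTop.comp ?_).const_mul_atTop ha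
    exact tendsto_atTop_add_const_right atTop (1 : ℝ) tendsto_natCast_atTop_atTop
  have hup : ∀ᶠ N in atTop, ∀ k ∈ Finset.range K, x k ≤ upperShift θ N k := by
    rw [Filter.eventually_all_finset]
    intro k _
    filter_upwards [hlim.eventually_ge_atTop (x k)] with N hN
    exact hN.trans (powLog_mono ha (Nat.le_add_left N k))
  -- Taking N ≥ K leaves only the prepended terms of the lower shift outside the range where x is
  -- δ-close to α ln k; M, chosen after N, pushes those below x.
  obtain ⟨N, hN1, hN2, hN3, hN4⟩ :=
    (hup.and (A.upperShift_super.and (A.lowerShift_sub.and (eventually_ge_atTop K)))).exists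
  have hlo : ∀ᶠ M : ℝ in atTop, ∀ k ∈ Finset.range N, lowerShift θ N M k ≤ x k := by
    rw [Filter.eventually_all_finset]
    intro k hk
    have hkN := Finset.mem_range.1 hk
    have hkN' : (k : ℝ) + 1 ≤ N := by exact_mod_cast hkN
    filter_upwards [eventually_ge_atTop (-x k), eventually_ge_atTop 0] with M hM hM0
    rw [lowerShift, if_pos hkN]
    nlinarith
  obtain ⟨M, hM1, hM2, hM3⟩ := (hlo.and (hN3.and (eventually_ge_atTop 0))).exists
  refine ⟨N, M, hM3, fun k => ?_, fun k => ?_, fun k => ?_, fun k => ?_⟩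
  · rcases lt_or_ge k K with hk | hk
    · linarith [hN1 k (Finset.mem_range.2 hk)]
    · linarith [(abs_lt.1 (hK' k hk)).2, powLog_le_upperShift h0 N k]
  · rcases lt_or_ge k N with hk | hk
    · linarith [hM1 k (Finset.mem_range.2 hk)]
    · linarith [(abs_lt.1 (hK' k (hN4.trans hk))).1, lowerShift_le_powLog h0 N hM3 k]
  · exact hN2 _ (A.logImage (bddDist_of_tendsto (tendsto_upperShift_sub h0 N))) k
  · exact hM2 _ (A.logImage (bddDist_of_tendsto (tendsto_lowerShift_sub h0 N hM3))) k

/-- The image of (α ln k) itself is caught between two shifts; nonexpansiveness transfers the bound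
to every sequence at bounded distance. -/
theorem Admissible.bddDist_logT {θ : ℝ} {Q x : ℕ → ℝ} (A : Admissible θ Q)
    (hx : BddDist x (powLog (fixedExponent θ))) :
    BddDist (logT θ Q x) (powLog (fixedExponent θ)) := by
  have h0 := A.pos
  have hself : BddDist (powLog (fixedExponent θ)) (powLog (fixedExponent θ)) := ⟨0, by simp⟩
  obtain ⟨N, M, hM, -, -, h3, h4⟩ := A.exists_enclosure
    (x := powLog (fixedExponent θ)) (by simp) one_pos
  have hu := bddDist_of_tendsto (tendsto_upperShift_sub h0 N)
  have hl := bddDist_of_tendsto (tendsto_lowerShift_sub h0 N hM)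
  obtain ⟨D, hD⟩ := hx
  obtain ⟨D1, hD1⟩ := hu
  obtain ⟨D2, hD2⟩ := hl
  refine BddDist.trans (y := logT θ Q (powLog (fixedExponent θ))) ⟨D, fun k => ?_⟩
    ⟨D1 + D2, fun k => ?_⟩
  · exact (A.logImage ⟨D, hD⟩).abs_sub_le h0 A.lt_pi (A.logImage hself) hD k
  · have e1 := A.logT_mono hself ⟨D1, hD1⟩ (powLog_le_upperShift h0 N) k
    have e2 := A.logT_mono ⟨D2, hD2⟩ hself (lowerShift_le_powLog h0 N hM) k
    have e3 := abs_le.1 (hD1 k)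
    have e4 := abs_le.1 (hD2 k)
    have e5 := h3 k
    have e6 := h4 k
    have e7 := (abs_nonneg _).trans (hD1 k)
    have e8 := (abs_nonneg _).trans (hD2 k)
    rw [abs_le]
    constructor <;> linarith

theorem Admissible.bddDist_iterate {θ : ℝ} {Q x : ℕ → ℝ} (A : Admissible θ Q)
    (hx : BddDist x (powLog (fixedExponent θ))) (n : ℕ) :
    BddDist ((logT θ Q)^[n] x) (powLog (fixedExponent θ)) := by
  induction n with
  | zero => exact hx
  | succ n ih =>
    rw [Function.iterate_succ_apply']
    exact A.bddDist_logT ih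

theorem Admissible.logImage_iterate {θ : ℝ} {Q x : ℕ → ℝ} (A : Admissible θ Q)
    (hx : BddDist x (powLog (fixedExponent θ))) (n : ℕ) :
    LogImage θ Q ((logT θ Q)^[n] x) ((logT θ Q)^[n + 1] x) := by
  rw [Function.iterate_succ_apply']
  exact A.logImage (A.bddDist_iterate hx n)

theorem Admissible.iterate_mono {θ : ℝ} {Q x x' : ℕ → ℝ} (A : Admissible θ Q)
    (hx : BddDist x (powLog (fixedExponent θ))) (hx' : BddDist x' (powLog (fixedExponent θ)))
    (h : ∀ k, x k ≤ x' k) (n k : ℕ) : (logT θ Q)^[n] x k ≤ (logT θ Q)^[n] x' k := by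
  induction n generalizing k with
  | zero => exact h k
  | succ n ih =>
    rw [Function.iterate_succ_apply', Function.iterate_succ_apply']
    exact A.logT_mono (A.bddDist_iterate hx n) (A.bddDist_iterate hx' n) ih k

theorem BddDist.add_const {x y : ℕ → ℝ} (h : BddDist x y) (c : ℝ) :
    BddDist (fun k => x k + c) y := by
  obtain ⟨D, hD⟩ := h
  refine ⟨D + |c|, fun k => ?_⟩
  rw [add_sub_right_comm]
  exact (abs_add_le _ _).trans (by linarith [hD k])

theorem Admissible.iterate_add_const {θ : ℝ} {Q x : ℕ → ℝ} (A : Admissible θ Q)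
    (hx : BddDist x (powLog (fixedExponent θ))) (c : ℝ) (n : ℕ) :
    (logT θ Q)^[n] (fun k => x k + c) = fun k => (logT θ Q)^[n] x k + c := by
  induction n with
  | zero => rfl
  | succ n ih =>
    rw [Function.iterate_succ_apply', ih]
    exact ((A.logImage_iterate hx n).add_const c).logT_eq A.pos A.lt_pi

/-- Between a subsolution and a supersolution, both monotone orbits converge to one fixed point. -/
theorem Admissible.exists_fixed_between {θ : ℝ} {Q l h : ℕ → ℝ} (A : Admissible θ Q)
    (hl : Tendsto (fun k => l k - powLog (fixedExponent θ) k) atTop (𝓝 0))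
    (hh : Tendsto (fun k => h k - powLog (fixedExponent θ) k) atTop (𝓝 0))
    (hlh : ∀ k, l k ≤ h k) (hsub : ∀ k, l k ≤ logT θ Q l k) (hsup : ∀ k, logT θ Q h k ≤ h k) :
    ∃ p, LogImage θ Q p p ∧ (∀ k, l k ≤ p k ∧ p k ≤ h k) ∧
      (∀ n k, l k ≤ (logT θ Q)^[n] l k ∧ (logT θ Q)^[n] h k ≤ h k) ∧
      (∀ k, Tendsto (fun n => (logT θ Q)^[n] l k) atTop (𝓝 (p k))) ∧
      (∀ k, Tendsto (fun n => (logT θ Q)^[n] h k) atTop (𝓝 (p k))) := by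
  have h0 := A.pos
  have hpi := A.lt_pi
  have bl := bddDist_of_tendsto hl
  have bh := bddDist_of_tendsto hh
  have monoL : ∀ k, Monotone fun n => (logT θ Q)^[n] l k := fun k => by
    refine monotone_nat_of_le_succ fun n => ?_
    rw [Function.iterate_succ_apply]
    exact A.iterate_mono bl (A.bddDist_logT bl) hsub n k
  have antiH : ∀ k, Antitone fun n => (logT θ Q)^[n] h k := fun k => by
    refine antitone_nat_of_succ_le fun n => ?_
    rw [Function.iterate_succ_apply]
    exact A.iterate_mono (A.bddDist_logT bh) bh hsup n k
  have hLH : ∀ n k, (logT θ Q)^[n] l k ≤ (logT θ Q)^[n] h k := A.iterate_mono bl bh hlh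
  have hL0 : ∀ n k, l k ≤ (logT θ Q)^[n] l k := fun n k => monoL k (Nat.zero_le n)
  have hH0 : ∀ n k, (logT θ Q)^[n] h k ≤ h k := fun n k => antiH k (Nat.zero_le n)
  have hLh : ∀ n k, (logT θ Q)^[n] l k ≤ h k := fun n k => (hLH n k).trans (hH0 n k)
  have hlH : ∀ n k, l k ≤ (logT θ Q)^[n] h k := fun n k => (hL0 n k).trans (hLH n k)
  have convL : ∀ k, ∃ q, Tendsto (fun n => (logT θ Q)^[n] l k) atTop (𝓝 q) := fun k =>
    ⟨_, tendsto_atTop_ciSup (monoL k) ⟨h k, by rintro _ ⟨n, rfl⟩; exact hLh n k⟩⟩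
  have convH : ∀ k, ∃ q, Tendsto (fun n => (logT θ Q)^[n] h k) atTop (𝓝 q) := fun k =>
    ⟨_, tendsto_atTop_ciInf (antiH k) ⟨l k, by rintro _ ⟨n, rfl⟩; exact hlH n k⟩⟩
  choose q hq using convL
  choose q' hq' using convH
  have hsum := bl.summable_exp_neg (one_lt_fixedExponent h0)
  have fq : LogImage θ Q q q :=
    logImage_of_tendsto h0 hpi (A.logImage_iterate bl) hsum hL0 hLh hq
  have fq' : LogImage θ Q q' q' :=
    logImage_of_tendsto h0 hpi (A.logImage_iterate bh) hsum hlH hH0 hq'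
  have hlq : ∀ k, l k ≤ q k := fun k => ge_of_tendsto' (hq k) fun n => hL0 n k
  have hqh : ∀ k, q k ≤ h k := fun k => le_of_tendsto' (hq k) fun n => hLh n k
  have hlq' : ∀ k, l k ≤ q' k := fun k => ge_of_tendsto' (hq' k) fun n => hlH n k
  have hqh' : ∀ k, q' k ≤ h k := fun k => le_of_tendsto' (hq' k) fun n => hH0 n k
  -- Both limits lie between l and h, whose difference tends to 0, so the uniqueness of fixed points
  -- applies.
  have hd : Tendsto (fun k => q k - q' k) atTop (𝓝 0) := by
    refine tendsto_of_tendsto_of_tendsto_of_le_of_le (g := fun k => l k - h k)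
      (h := fun k => h k - l k) ?_ ?_ (fun k => ?_) (fun k => ?_)
    · simpa using hl.sub hh
    · simpa using hh.sub hl
    · simp only; linarith [hlq k, hqh' k]
    · simp only; linarith [hqh k, hlq' k]
  obtain rfl := eq_of_tendsto_sub_zero h0 hpi fq fq' hd
  exact ⟨q, fq, fun k => ⟨hlq k, hqh k⟩, fun n k => ⟨hL0 n k, hH0 n k⟩, hq, hq'⟩

/-- The rate 1/k comes from the enclosing shifts: ln(k ± N) - ln k = O(1/k). -/
theorem Admissible.exists_fixed {θ : ℝ} {Q : ℕ → ℝ} (A : Admissible θ Q) :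
    ∃ p, LogImage θ Q p p ∧ ∃ C, 0 < C ∧ ∀ k : ℕ,
      |p k - powLog (fixedExponent θ) k| ≤ C * ((k : ℝ) + 1) ^ (-1 : ℝ) := by
  have h0 := A.pos
  obtain ⟨N, M, hM, -, -, h3, h4⟩ := A.exists_enclosure
    (x := powLog (fixedExponent θ)) (by simp) one_pos
  obtain ⟨p, hp, hb, -⟩ := A.exists_fixed_between (tendsto_lowerShift_sub h0 N hM)
    (tendsto_upperShift_sub h0 N)
    (fun k => (lowerShift_le_powLog h0 N hM k).trans (powLog_le_upperShift h0 N k)) h4 h3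
  obtain ⟨C1, hC1, h1⟩ := abs_upperShift_sub_le h0 N
  obtain ⟨C2, hC2, h2⟩ := abs_lowerShift_sub_le h0 N hM
  refine ⟨p, hp, C1 + C2, by positivity, fun k => ?_⟩
  have e1 := abs_le.1 (h1 k)
  have e2 := abs_le.1 (h2 k)
  have e3 := hb k
  have e4 := (abs_nonneg _).trans (h1 k)
  have e5 := (abs_nonneg _).trans (h2 k)
  rw [add_mul, abs_le]
  constructor <;> linarith

/-- Global attraction, uniformly in the index. -/
theorem Admissible.eventually_iterate_close {θ : ℝ} {Q p x : ℕ → ℝ} (A : Admissible θ Q)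
    (hp : LogImage θ Q p p)
    (hp0 : Tendsto (fun k => p k - powLog (fixedExponent θ) k) atTop (𝓝 0))
    (hx : Tendsto (fun k => x k - powLog (fixedExponent θ) k) atTop (𝓝 0)) {δ : ℝ} (hδ : 0 < δ) :
    ∀ᶠ n in atTop, ∀ k, |(logT θ Q)^[n] x k - p k| ≤ δ := by
  have h0 := A.pos
  obtain ⟨N, M, hM, h1, h2, h3, h4⟩ := A.exists_enclosure hx (half_pos hδ)
  set h := upperShift θ N
  set l := lowerShift θ N M
  have hh := tendsto_upperShift_sub h0 N
  have hl := tendsto_lowerShift_sub h0 N hM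
  obtain ⟨q, hq, hb, hmon, hlq, hhq⟩ := A.exists_fixed_between hl hh
    (fun k => (lowerShift_le_powLog h0 N hM k).trans (powLog_le_upperShift h0 N k)) h4 h3
  have hqp : Tendsto (fun k => q k - p k) atTop (𝓝 0) := by
    refine tendsto_of_tendsto_of_tendsto_of_le_of_le (g := fun k => l k - p k)
      (h := fun k => h k - p k) ?_ ?_ (fun k => ?_) (fun k => ?_)
    · simpa using hl.sub hp0
    · simpa using hh.sub hp0
    · simp only; linarith [hb k]
    · simp only; linarith [hb k]
  obtain rfl := eq_of_tendsto_sub_zero h0 A.lt_pi hq hp hqp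
  have hlh : Tendsto (fun k => h k - l k) atTop (𝓝 0) := by simpa using hh.sub hl
  obtain ⟨K, hK⟩ := eventually_atTop.1 (hlh.eventually (gt_mem_nhds (half_pos hδ)))
  -- Pointwise convergence handles finitely many indices; beyond K the enclosure h - l is itself
  -- below δ/2 for every n, which makes the estimate uniform in k.
  have hfin : ∀ᶠ n in atTop, ∀ k ∈ Finset.range K,
      q k - δ / 2 < (logT θ Q)^[n] l k ∧ (logT θ Q)^[n] h k < q k + δ / 2 := by
    rw [Filter.eventually_all_finset]
    intro k _
    exact ((hlq k).eventually (lt_mem_nhds (by linarith))).and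
      ((hhq k).eventually (gt_mem_nhds (by linarith)))
  have bx := bddDist_of_tendsto hx
  have bl := bddDist_of_tendsto hl
  have bh := bddDist_of_tendsto hh
  filter_upwards [hfin] with n hn k
  have e1 := A.iterate_mono bx (bh.add_const (δ / 2)) h1 n k
  have e2 := A.iterate_mono (bl.add_const (-(δ / 2))) bx
    (fun k => by linarith [h2 k]) n k
  rw [A.iterate_add_const bh] at e1
  rw [A.iterate_add_const bl] at e2
  rw [abs_le]
  rcases lt_or_ge k K with hk | hk
  · have := hn k (Finset.mem_range.2 hk)
    constructor <;> linarith
  · have := hK k hk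
    have := hmon n k
    have := hb k
    constructor <;> linarith

theorem Admissible.tendsto_logT_sub {θ : ℝ} {Q x : ℕ → ℝ} (A : Admissible θ Q)
    (hx : Tendsto (fun k => x k - powLog (fixedExponent θ) k) atTop (𝓝 0)) :
    Tendsto (fun k => logT θ Q x k - powLog (fixedExponent θ) k) atTop (𝓝 0) := by
  have h0 := A.pos
  rw [Metric.tendsto_atTop']
  intro δ hδ
  obtain ⟨N, M, hM, h1, h2, h3, h4⟩ := A.exists_enclosure hx (half_pos hδ)
  have hh := tendsto_upperShift_sub h0 N
  have hl := tendsto_lowerShift_sub h0 N hM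
  have bx := bddDist_of_tendsto hx
  have bl := bddDist_of_tendsto hl
  have bh := bddDist_of_tendsto hh
  have hev := (hh.eventually (gt_mem_nhds (half_pos hδ))).and
    (hl.eventually (lt_mem_nhds (neg_neg_of_pos (half_pos hδ))))
  obtain ⟨K, hK⟩ := eventually_atTop.1 hev
  refine ⟨K, fun k hk => ?_⟩
  have e1 := ((A.logImage bx).mono h0 A.lt_pi ((A.logImage bh).add_const (δ / 2)) h1) k
  have e2 := (((A.logImage bl).add_const (-(δ / 2))).mono h0 A.lt_pi (A.logImage bx)
    (fun k => by linarith [h2 k])) k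
  have e3 := hK k hk.le
  have e4 := h3 k
  have e5 := h4 k
  rw [Real.dist_eq, sub_zero, abs_lt]
  constructor <;> linarith [e3.1, e3.2]

/-! ### Riemann sums of the density -/

open MeasureTheory Set in
/-- The integral of a step function with steps of length `1 / m`. -/
theorem hasSum_step {F : ℕ → ℝ} {m : ℝ} (hm : 0 < m)
    (hF : IntegrableOn (fun s => F (⌈m * s⌉₊ - 1)) (Ioi 0)) :
    HasSum (fun k => F k / m) (∫ s in Ioi (0 : ℝ), F (⌈m * s⌉₊ - 1)) := by
  -- Cells are open on the left, so the ceiling is positive on them and the truncated subtraction of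
  -- 1 is exact.
  have hmem : ∀ (k : ℕ) (s : ℝ), s ∈ Ioc ((k : ℝ) / m) ((k + 1) / m) ↔ ⌈m * s⌉₊ = k + 1 := by
    intro k s
    rw [Nat.ceil_eq_iff (by omega), mem_Ioc, div_lt_iff₀ hm, le_div_iff₀ hm, mul_comm s]
    simp
  have hunion : ⋃ k : ℕ, Ioc ((k : ℝ) / m) ((k + 1) / m) = Ioi 0 := by
    ext s
    simp only [mem_iUnion, hmem, mem_Ioi]
    constructor
    · rintro ⟨k, hk⟩
      have : 0 < m * s := Nat.ceil_pos.1 (by omega)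
      exact pos_of_mul_pos_right this hm.le
    · intro hs
      have : 0 < ⌈m * s⌉₊ := Nat.ceil_pos.2 (mul_pos hm hs)
      exact ⟨⌈m * s⌉₊ - 1, by omega⟩
  have hdisj : Pairwise (Function.onFun Disjoint
      fun k : ℕ => Ioc ((k : ℝ) / m) (((k : ℝ) + 1) / m)) := by
    intro i j hij
    refine disjoint_left.2 fun s hi hj => hij ?_
    rw [hmem] at hi hj
    omega
  have h := hasSum_integral_iUnion (fun k : ℕ => measurableSet_Ioc) hdisj (hunion ▸ hF)
  rw [hunion] at h
  have hval : ∀ k : ℕ, ∫ s in Ioc ((k : ℝ) / m) (((k : ℝ) + 1) / m), F (⌈m * s⌉₊ - 1)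
      = F k / m := by
    intro k
    have hc : ∀ s ∈ Ioc ((k : ℝ) / m) (((k : ℝ) + 1) / m), F (⌈m * s⌉₊ - 1) = F k := by
      intro s hs
      rw [(hmem k s).1 hs, Nat.add_sub_cancel]
    have hle : (k : ℝ) / m ≤ ((k : ℝ) + 1) / m := by gcongr; linarith
    rw [setIntegral_congr_fun measurableSet_Ioc hc, setIntegral_const, Real.volume_real_Ioc_of_le hle,
      smul_eq_mul]
    field_simp
    ring
  simpa only [hval] using h

/-- A dominating function for the Riemann sums. -/
def riemannBound (a ε s : ℝ) : ℝ := if s ≤ 1 then 1 + s ^ (a - ε) else s ^ (-a)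

open MeasureTheory Set in
theorem integrableOn_riemannBound {a ε : ℝ} (ha : 1 < a) (hε : ε < a + 1) :
    IntegrableOn (riemannBound a ε) (Ioi 0) := by
  rw [← Ioc_union_Ioi_eq_Ioi (zero_le_one (α := ℝ))]
  refine IntegrableOn.union ?_ ?_
  · have h1 : IntegrableOn (fun s : ℝ => s ^ (a - ε)) (Ioc 0 1) :=
      (intervalIntegrable_iff_integrableOn_Ioc_of_le zero_le_one).1
        (intervalIntegral.intervalIntegrable_rpow' (by linarith))
    have h2 : IntegrableOn (fun _ : ℝ => (1 : ℝ)) (Ioc 0 1) := by simp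
    refine (h2.add h1).congr_fun (fun s hs => ?_) measurableSet_Ioc
    simp [riemannBound, hs.2]
  · refine (integrableOn_Ioi_rpow_of_lt (neg_lt_neg ha) one_pos).congr_fun (fun s hs => ?_)
      measurableSet_Ioi
    rw [riemannBound, if_neg (not_le.2 (mem_Ioi.1 hs))]

/-- The sampling point t is the right end of the cell containing s, so only s ≤ t is known. For s ≤
1 the summand 1 covers t > 1 and nonnegative exponents a - ε; s^(a - ε) covers negative ones. -/
theorem exp_neg_abs_log_mul_le {a ε s t : ℝ} (ha : 1 < a) (hε : 0 ≤ ε) (hs : 0 < s)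
    (hst : s ≤ t) : Real.exp (-(a * |Real.log t|)) * t ^ (-ε) ≤ riemannBound a ε s := by
  have ht : 0 < t := hs.trans_le hst
  have ha0 : 0 < a := by linarith
  have h1 : Real.exp (-(a * |Real.log t|)) ≤ t ^ a := by
    rw [Real.rpow_def_of_pos ht]
    apply Real.exp_le_exp.2
    nlinarith [neg_abs_le (Real.log t)]
  have h2 : Real.exp (-(a * |Real.log t|)) ≤ t ^ (-a) := by
    rw [Real.rpow_def_of_pos ht]
    apply Real.exp_le_exp.2
    nlinarith [le_abs_self (Real.log t)]
  have h3 : Real.exp (-(a * |Real.log t|)) ≤ 1 := by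
    rw [Real.exp_le_one_iff]
    nlinarith [abs_nonneg (Real.log t)]
  have hpos : 0 < t ^ (-ε) := Real.rpow_pos_of_pos ht _
  have hsp : 0 < s ^ (a - ε) := Real.rpow_pos_of_pos hs _
  unfold riemannBound
  split_ifs with h
  · rcases le_or_gt t 1 with htl | htl
    · calc _ ≤ t ^ a * t ^ (-ε) := mul_le_mul_of_nonneg_right h1 hpos.le
        _ = t ^ (a - ε) := by rw [← Real.rpow_add ht, sub_eq_add_neg]
        _ ≤ 1 + s ^ (a - ε) := by
          rcases le_or_gt 0 (a - ε) with he | he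
          · linarith [Real.rpow_le_one ht.le htl he]
          · linarith [Real.rpow_le_rpow_of_nonpos hs hst he.le]
    · have := Real.rpow_le_one_of_one_le_of_nonpos htl.le (neg_nonpos.2 hε)
      calc _ ≤ 1 * 1 := mul_le_mul h3 this hpos.le zero_le_one
        _ ≤ _ := by linarith
  · have hs1 : 1 < s := not_le.1 h
    have := Real.rpow_le_one_of_one_le_of_nonpos (hs1.le.trans hst) (neg_nonpos.2 hε)
    calc _ ≤ t ^ (-a) * 1 :=
          mul_le_mul h2 this hpos.le (Real.rpow_pos_of_pos ht _).le
      _ ≤ _ := by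
        rw [mul_one]
        exact Real.rpow_le_rpow_of_nonpos hs hst (by linarith)

/-- The limit of the Riemann sums. -/
def densityMoment (θ ε : ℝ) : ℝ :=
  ∫ s in Set.Ioi (0 : ℝ), phaseDensity θ (fixedExponent θ * Real.log s) * s ^ (-ε)

open MeasureTheory Set in
theorem integrableOn_densityMoment {θ ε : ℝ} (h0 : 0 < θ) (hpi : θ < Real.pi) (hε : 0 ≤ ε)
    (hε' : ε < fixedExponent θ + 1) :
    IntegrableOn (fun s => phaseDensity θ (fixedExponent θ * Real.log s) * s ^ (-ε)) (Ioi 0) := by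
  have ha := one_lt_fixedExponent h0
  refine Integrable.mono' ((integrableOn_riemannBound ha hε').const_mul (Real.sin θ)⁻¹) ?_ ?_
  · apply Measurable.aestronglyMeasurable
    unfold phaseDensity
    fun_prop
  · filter_upwards [ae_restrict_mem measurableSet_Ioi] with s hs
    have hs0 : 0 < s := hs
    have h1 := phaseDensity_le_exp h0 hpi (fixedExponent θ * Real.log s)
    have h2 := exp_neg_abs_log_mul_le ha hε hs0 le_rfl
    have hsin : 0 < (Real.sin θ)⁻¹ := inv_pos.2 (Real.sin_pos_of_pos_of_lt_pi h0 hpi)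
    rw [abs_mul, abs_of_pos (by linarith : 0 < fixedExponent θ)] at h1
    have hp : 0 < s ^ (-ε) := Real.rpow_pos_of_pos hs0 _
    rw [Real.norm_of_nonneg (mul_nonneg (phaseDensity_pos h0 hpi _).le hp.le)]
    calc _ ≤ (Real.sin θ)⁻¹ * Real.exp (-(fixedExponent θ * |Real.log s|)) * s ^ (-ε) := by
          gcongr
      _ = (Real.sin θ)⁻¹ * (Real.exp (-(fixedExponent θ * |Real.log s|)) * s ^ (-ε)) := by ring
      _ ≤ _ := by gcongr

-- With cells of length 1/(j + 1), the rescaled sum is the integral of a step function. Dominated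
-- convergence applies because p_k - p_j is close to α ln((k + 1)/(j + 1)); the bounded deviation of
-- p costs only a factor e^{2D}.
open MeasureTheory Set in
theorem tendsto_riemannSum {θ ε : ℝ} {p : ℕ → ℝ} (h0 : 0 < θ) (hpi : θ < Real.pi) (hε : 0 ≤ ε)
    (hε' : ε < fixedExponent θ + 1)
    (hp : Tendsto (fun k => p k - powLog (fixedExponent θ) k) atTop (𝓝 0)) :
    (∀ j, Summable fun k : ℕ => phaseDensity θ (p k - p j) * ((k : ℝ) + 1) ^ (-ε)) ∧
    Tendsto (fun j : ℕ => (∑' k : ℕ, phaseDensity θ (p k - p j) * ((k : ℝ) + 1) ^ (-ε))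
      * (((j : ℝ) + 1) ^ ε / ((j : ℝ) + 1))) atTop (𝓝 (densityMoment θ ε)) := by
  have ha := one_lt_fixedExponent h0
  set a := fixedExponent θ with ha_def
  have ha0 : 0 < a := by linarith
  obtain ⟨D, hD⟩ := bddDist_of_tendsto hp
  have hsin : 0 < (Real.sin θ)⁻¹ := inv_pos.2 (Real.sin_pos_of_pos_of_lt_pi h0 hpi)
  set F : ℕ → ℕ → ℝ := fun j k =>
    phaseDensity θ (p k - p j) * (((k : ℝ) + 1) / ((j : ℝ) + 1)) ^ (-ε) with hF
  set f : ℕ → ℝ → ℝ := fun j s => F j (⌈((j : ℝ) + 1) * s⌉₊ - 1) with hf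
  have hm : ∀ j : ℕ, (0 : ℝ) < (j : ℝ) + 1 := fun j => by positivity
  have hdiff : ∀ k j : ℕ, p k - p j = (p k - powLog a k) - (p j - powLog a j)
      + a * Real.log (((k : ℝ) + 1) / ((j : ℝ) + 1)) := by
    intro k j
    rw [Real.log_div (hm k).ne' (hm j).ne', powLog, powLog]
    ring
  have hidx : ∀ (j : ℕ) (s : ℝ), 0 < s →
      ((⌈((j : ℝ) + 1) * s⌉₊ - 1 : ℕ) : ℝ) + 1 = ⌈((j : ℝ) + 1) * s⌉₊ := by
    intro j s hs
    have : 0 < ⌈((j : ℝ) + 1) * s⌉₊ := Nat.ceil_pos.2 (mul_pos (hm j) hs)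
    exact_mod_cast Nat.sub_add_cancel this
  have hmeas : ∀ j, Measurable (f j) := fun j =>
    (measurable_from_nat (f := fun n => F j (n - 1))).comp (Nat.measurable_ceil.comp (by fun_prop))
  have hbound : ∀ j, ∀ s ∈ Ioi (0 : ℝ),
      ‖f j s‖ ≤ (Real.sin θ)⁻¹ * Real.exp (2 * D) * riemannBound a ε s := by
    intro j s hs
    have hs0 : 0 < s := hs
    set i := ⌈((j : ℝ) + 1) * s⌉₊ - 1
    set t := ((i : ℝ) + 1) / ((j : ℝ) + 1) with ht
    have hst : s ≤ t := by
      rw [ht, hidx j s hs0, le_div_iff₀ (hm j), mul_comm]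
      exact Nat.le_ceil _
    have ht0 : 0 < t := hs0.trans_le hst
    have hpos : 0 < t ^ (-ε) := Real.rpow_pos_of_pos ht0 _
    have hnn : 0 ≤ f j s := mul_nonneg (phaseDensity_pos h0 hpi _).le hpos.le
    rw [Real.norm_of_nonneg hnn]
    have h1 := phaseDensity_le_exp h0 hpi (p i - p j)
    have h2 : a * |Real.log t| - 2 * D ≤ |p i - p j| := by
      have e1 := abs_le.1 (hD i)
      have e2 := abs_le.1 (hD j)
      have e3 := hdiff i j
      have e4 : |a * Real.log t| ≤ |p i - p j| + 2 * D := by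
        rw [abs_le]
        constructor <;> linarith [neg_abs_le (p i - p j), le_abs_self (p i - p j)]
      rw [abs_mul, abs_of_pos ha0] at e4
      linarith
    calc f j s ≤ (Real.sin θ)⁻¹ * Real.exp (-|p i - p j|) * t ^ (-ε) :=
          mul_le_mul_of_nonneg_right h1 hpos.le
      _ ≤ (Real.sin θ)⁻¹ * (Real.exp (2 * D) * Real.exp (-(a * |Real.log t|))) * t ^ (-ε) := by
          rw [← Real.exp_add]
          gcongr
          linarith
      _ = (Real.sin θ)⁻¹ * Real.exp (2 * D)
          * (Real.exp (-(a * |Real.log t|)) * t ^ (-ε)) := by ring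
      _ ≤ _ := by
          gcongr
          exact exp_neg_abs_log_mul_le ha hε hs0 hst
  have hBint := (integrableOn_riemannBound ha hε').const_mul ((Real.sin θ)⁻¹ * Real.exp (2 * D))
  have hint : ∀ j, IntegrableOn (f j) (Ioi 0) := fun j => by
    refine Integrable.mono' hBint (hmeas j).aestronglyMeasurable ?_
    filter_upwards [ae_restrict_mem measurableSet_Ioi] with s hs using hbound j s hs
  have hsum : ∀ j, HasSum (fun k : ℕ => F j k / ((j : ℝ) + 1)) (∫ s in Ioi (0 : ℝ), f j s) :=
    fun j => hasSum_step (hm j) (hint j)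
  have hterm : ∀ j k : ℕ, F j k / ((j : ℝ) + 1)
      = phaseDensity θ (p k - p j) * ((k : ℝ) + 1) ^ (-ε)
        * (((j : ℝ) + 1) ^ ε / ((j : ℝ) + 1)) := by
    intro j k
    simp only [hF]
    rw [Real.div_rpow (hm k).le (hm j).le, Real.rpow_neg (hm j).le]
    field_simp
  have hc : ∀ j : ℕ, ((j : ℝ) + 1) ^ ε / ((j : ℝ) + 1) ≠ 0 := fun j =>
    (div_pos (rpow_weight_pos ε j) (hm j)).ne'
  have hS : ∀ j, Summable fun k : ℕ => phaseDensity θ (p k - p j) * ((k : ℝ) + 1) ^ (-ε) := by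
    intro j
    have := (hsum j).summable
    simp only [hterm] at this
    exact (summable_mul_right_iff (hc j)).1 this
  refine ⟨hS, ?_⟩
  have heq : (fun j : ℕ => (∑' k : ℕ, phaseDensity θ (p k - p j) * ((k : ℝ) + 1) ^ (-ε))
      * (((j : ℝ) + 1) ^ ε / ((j : ℝ) + 1))) = fun j => ∫ s in Ioi (0 : ℝ), f j s := by
    funext j
    rw [← tsum_mul_right, ← (hsum j).tsum_eq]
    simp only [hterm]
  rw [heq]
  refine tendsto_integral_of_dominated_convergence _ (fun j => (hmeas j).aestronglyMeasurable)
    hBint (fun j => ?_) ?_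
  · filter_upwards [ae_restrict_mem measurableSet_Ioi] with s hs using hbound j s hs
  · filter_upwards [ae_restrict_mem measurableSet_Ioi] with s hs
    have hs0 : 0 < s := hs
    have hjt : Tendsto (fun j : ℕ => (j : ℝ) + 1) atTop atTop :=
      tendsto_atTop_add_const_right atTop (1 : ℝ) tendsto_natCast_atTop_atTop
    have hratio : Tendsto (fun j : ℕ => (((⌈((j : ℝ) + 1) * s⌉₊ - 1 : ℕ) : ℝ) + 1) / ((j : ℝ) + 1))
        atTop (𝓝 s) := by
      have h := (tendsto_nat_ceil_mul_div_atTop (R := ℝ) hs0.le).comp hjt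
      refine h.congr fun j => ?_
      simp only [Function.comp]
      rw [hidx j s hs0, mul_comm s]
    have hi : Tendsto (fun j : ℕ => ⌈((j : ℝ) + 1) * s⌉₊ - 1) atTop atTop :=
      (tendsto_sub_atTop_nat 1).comp (tendsto_nat_ceil_atTop.comp (hjt.atTop_mul_const hs0))
    -- For fixed s > 0 the sampled index also tends to infinity, so both deviations of p from α ln
    -- vanish in the limit.
    have harg : Tendsto (fun j : ℕ => p (⌈((j : ℝ) + 1) * s⌉₊ - 1) - p j) atTop
        (𝓝 (a * Real.log s)) := by
      have h := ((hp.comp hi).sub hp).add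
        (((Real.continuousAt_log hs0.ne').tendsto.comp hratio).const_mul a)
      rw [sub_zero, zero_add] at h
      refine h.congr fun j => ?_
      rw [hdiff]
      rfl
    exact (((phaseDensity_continuous h0 hpi).tendsto _).comp harg).mul
      (((Real.continuousAt_rpow_const s (-ε) (Or.inl hs0.ne')).tendsto).comp hratio)

-- Substitute s ↦ 1/s: the density is even in log s, and the Jacobian is s^{-2}.
open MeasureTheory Set in
theorem densityMoment_two {θ : ℝ} : densityMoment θ 2 = densityMoment θ 0 := by
  have h := integral_comp_rpow_Ioi
    (fun s => phaseDensity θ (fixedExponent θ * Real.log s)) (p := -1) (by norm_num)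
  rw [densityMoment, densityMoment]
  simp only [neg_zero, Real.rpow_zero, mul_one]
  rw [← h]
  refine setIntegral_congr_fun measurableSet_Ioi fun s hs => ?_
  have hs0 : 0 < s := hs
  simp only [Real.log_rpow hs0, smul_eq_mul, abs_neg, abs_one, one_mul]
  rw [show fixedExponent θ * (-1 * Real.log s) = -(fixedExponent θ * Real.log s) by ring,
    phaseDensity_neg, mul_comm]
  norm_num

/-- Strict convexity of ε ↦ s^{-ε} between the endpoints 0 and 2. -/
theorem rpow_neg_lt {ε s : ℝ} (hε : 0 < ε) (hε' : ε < 2) (hs : 0 < s) (hs1 : s ≠ 1) :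
    s ^ (-ε) < (1 - ε / 2) + ε / 2 * s ^ (-2 : ℝ) := by
  have hlog : Real.log s ≠ 0 := Real.log_ne_zero_of_pos_of_ne_one hs hs1
  have h := strictConvexOn_exp.2 (Set.mem_univ (0 : ℝ)) (Set.mem_univ (Real.log s * -2))
    (by contrapose! hlog; linarith) (by linarith : 0 < 1 - ε / 2) (by linarith : 0 < ε / 2)
    (by ring)
  simp only [smul_eq_mul, mul_zero, zero_add, Real.exp_zero, mul_one] at h
  rw [Real.rpow_def_of_pos hs, Real.rpow_def_of_pos hs]
  rw [show Real.log s * -ε = ε / 2 * (Real.log s * -2) by ring]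
  exact h

open MeasureTheory Set in
theorem densityMoment_pos {θ : ℝ} (h0 : 0 < θ) (hpi : θ < Real.pi) : 0 < densityMoment θ 0 := by
  have ha := one_lt_fixedExponent h0
  have hi := integrableOn_densityMoment h0 hpi le_rfl (by linarith)
  have hpos : ∀ s ∈ Ioi (0 : ℝ),
      0 < phaseDensity θ (fixedExponent θ * Real.log s) * s ^ (-0 : ℝ) := fun s hs =>
    mul_pos (phaseDensity_pos h0 hpi _) (Real.rpow_pos_of_pos hs _)
  refine (setIntegral_pos_iff_support_of_nonneg_ae ?_ hi).2 ?_
  · filter_upwards [ae_restrict_mem measurableSet_Ioi] with s hs using (hpos s hs).le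
  · refine lt_of_lt_of_le ?_ (measure_mono (s := Ioi (0 : ℝ))
      fun s hs => ⟨(hpos s hs).ne', hs⟩)
    simp

-- Integrating the convexity inequality bounds the moment strictly by a convex combination of the
-- moments at 0 and 2, which coincide.
open MeasureTheory Set in
theorem densityMoment_lt {θ ε : ℝ} (h0 : 0 < θ) (hpi : θ < Real.pi) (hε : 0 < ε) (hε' : ε < 2) :
    densityMoment θ ε < densityMoment θ 0 := by
  have ha := one_lt_fixedExponent h0
  have i0 := integrableOn_densityMoment h0 hpi le_rfl (by linarith)
  have i1 := integrableOn_densityMoment h0 hpi hε.le (by linarith)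
  have i2 := integrableOn_densityMoment h0 hpi zero_le_two (by linarith)
  set g : ℝ → ℝ := fun s => phaseDensity θ (fixedExponent θ * Real.log s) with hg
  set d : ℝ → ℝ := fun s => (1 - ε / 2) * (g s * s ^ (-0 : ℝ)) + ε / 2 * (g s * s ^ (-2 : ℝ))
    - g s * s ^ (-ε) with hd
  have hgpos : ∀ s, 0 < g s := fun s => phaseDensity_pos h0 hpi _
  have hdpos : ∀ s ∈ Ioi (0 : ℝ), s ≠ 1 → 0 < d s := by
    intro s hs hs1
    have e : d s = g s * ((1 - ε / 2) + ε / 2 * s ^ (-2 : ℝ) - s ^ (-ε)) := by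
      simp only [hd, neg_zero, Real.rpow_zero]
      ring
    rw [e]
    exact mul_pos (hgpos s) (sub_pos.2 (rpow_neg_lt hε hε' hs hs1))
  have hdint : IntegrableOn d (Ioi 0) := ((i0.const_mul _).add (i2.const_mul _)).sub i1
  have hpos : 0 < ∫ s in Ioi (0 : ℝ), d s := by
    refine (setIntegral_pos_iff_support_of_nonneg_ae ?_ hdint).2 ?_
    · have hne : ∀ᵐ s ∂(volume.restrict (Ioi (0 : ℝ))), s ≠ 1 :=
        ae_restrict_of_ae (compl_mem_ae_iff.2 (measure_singleton (1 : ℝ)))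
      filter_upwards [ae_restrict_mem measurableSet_Ioi, hne] with s hs hs1
      exact (hdpos s hs hs1).le
    · refine lt_of_lt_of_le ?_ (measure_mono (s := Ioi (1 : ℝ)) fun s hs => ?_)
      · simp
      · have hs0 : (0 : ℝ) < s := one_pos.trans hs
        exact ⟨(hdpos s hs0 (ne_of_gt hs)).ne', hs0⟩
  have hval : ∫ s in Ioi (0 : ℝ), d s = (1 - ε / 2) * densityMoment θ 0
      + ε / 2 * densityMoment θ 2 - densityMoment θ ε := by
    have e1 := integral_sub ((i0.const_mul (1 - ε / 2)).add (i2.const_mul (ε / 2))) i1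
    have e2 := integral_add (i0.const_mul (1 - ε / 2)) (i2.const_mul (ε / 2))
    rw [integral_const_mul, integral_const_mul] at e2
    simp only [Pi.add_apply] at e1
    rw [e2] at e1
    exact e1
  rw [hval, densityMoment_two] at hpos
  linarith

/-! ### Weighted averages -/

theorem tendsto_ratio {θ ε : ℝ} {p : ℕ → ℝ} (h0 : 0 < θ) (hpi : θ < Real.pi) (hε : 0 ≤ ε)
    (hε' : ε < fixedExponent θ + 1)
    (hp : Tendsto (fun k => p k - powLog (fixedExponent θ) k) atTop (𝓝 0)) :
    Tendsto (fun j : ℕ => (∑' k : ℕ, phaseDensity θ (p k - p j) * ((k : ℝ) + 1) ^ (-ε))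
      / (((j : ℝ) + 1) ^ (-ε) * ∑' k : ℕ, phaseDensity θ (p k - p j))) atTop
      (𝓝 (densityMoment θ ε / densityMoment θ 0)) := by
  have ha := one_lt_fixedExponent h0
  have t1 := (tendsto_riemannSum h0 hpi hε hε' hp).2
  have t0 := (tendsto_riemannSum h0 hpi le_rfl (by linarith) hp).2
  simp only [neg_zero, Real.rpow_zero, mul_one] at t0
  refine (t1.div t0 (densityMoment_pos h0 hpi).ne').congr fun j => ?_
  have hj : (0 : ℝ) < (j : ℝ) + 1 := by positivity
  have hw := rpow_weight_pos ε j
  simp only [Pi.div_apply]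
  rw [Real.rpow_neg hj.le]
  field_simp

theorem summable_phaseDensity {θ : ℝ} {p : ℕ → ℝ} (h0 : 0 < θ) (hpi : θ < Real.pi)
    (hp : Tendsto (fun k => p k - powLog (fixedExponent θ) k) atTop (𝓝 0)) (j : ℕ) :
    Summable fun k => phaseDensity θ (p k - p j) := by
  have := (tendsto_riemannSum h0 hpi le_rfl (by linarith [one_lt_fixedExponent h0]) hp).1 j
  simpa using this

theorem tsum_phaseDensity_pos {θ : ℝ} {p : ℕ → ℝ} (h0 : 0 < θ) (hpi : θ < Real.pi)
    (hp : Tendsto (fun k => p k - powLog (fixedExponent θ) k) atTop (𝓝 0)) (j : ℕ) :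
    0 < ∑' k, phaseDensity θ (p k - p j) :=
  (summable_phaseDensity h0 hpi hp j).tsum_pos (fun _ => (phaseDensity_pos h0 hpi _).le) 0
    (phaseDensity_pos h0 hpi _)

theorem exists_average_le {θ ε : ℝ} {p : ℕ → ℝ} (h0 : 0 < θ) (hpi : θ < Real.pi) (hε : 0 ≤ ε)
    (hε' : ε < fixedExponent θ + 1)
    (hp : Tendsto (fun k => p k - powLog (fixedExponent θ) k) atTop (𝓝 0)) :
    ∃ C, 0 < C ∧ ∀ j : ℕ, ∑' k : ℕ, phaseDensity θ (p k - p j) * ((k : ℝ) + 1) ^ (-ε)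
      ≤ C * (((j : ℝ) + 1) ^ (-ε) * ∑' k : ℕ, phaseDensity θ (p k - p j)) := by
  obtain ⟨C, hC⟩ := (tendsto_ratio h0 hpi hε hε' hp).bddAbove_range
  refine ⟨max C 1, by positivity, fun j => ?_⟩
  have h := (hC ⟨j, rfl⟩).trans (le_max_left C 1)
  rwa [div_le_iff₀ (mul_pos (rpow_weight_pos _ j) (tsum_phaseDensity_pos h0 hpi hp j))] at h

/-- The weight `k ^ (-ε)`, made constant up to the index `J`. -/
def flatWeight (ε : ℝ) (J k : ℕ) : ℝ := (((max k J : ℕ) : ℝ) + 1) ^ (-ε)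

theorem flatWeight_pos (ε : ℝ) (J k : ℕ) : 0 < flatWeight ε J k := rpow_weight_pos _ _

theorem flatWeight_le {ε : ℝ} (hε : 0 ≤ ε) (J k : ℕ) : flatWeight ε J k ≤ ((k : ℝ) + 1) ^ (-ε) := by
  have : (k : ℝ) ≤ (max k J : ℕ) := by exact_mod_cast le_max_left k J
  exact Real.rpow_le_rpow_of_nonpos (by positivity) (by linarith) (by linarith)

/-- The two weights are equivalent because max(k, J) + 1 ≤ (J + 1)(k + 1). -/
theorem le_mul_flatWeight {ε : ℝ} (hε : 0 ≤ ε) (J k : ℕ) :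
    ((k : ℝ) + 1) ^ (-ε) ≤ ((J : ℝ) + 1) ^ ε * flatWeight ε J k := by
  have hk : (0 : ℝ) < (k : ℝ) + 1 := by positivity
  have hJ : (0 : ℝ) < (J : ℝ) + 1 := by positivity
  have hm : (0 : ℝ) < ((max k J : ℕ) : ℝ) + 1 := by positivity
  rw [flatWeight, Real.rpow_neg hk.le, Real.rpow_neg hm.le, ← div_eq_mul_inv,
    le_div_iff₀ (Real.rpow_pos_of_pos hm _), inv_mul_eq_div, div_le_iff₀ (rpow_weight_pos ε k),
    ← Real.mul_rpow hJ.le hk.le]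
  refine Real.rpow_le_rpow hm.le ?_ hε
  have h1 : ((max k J : ℕ) : ℝ) ≤ k + J := by
    exact_mod_cast max_le (Nat.le_add_right k J) (Nat.le_add_left J k)
  have h2 : (0 : ℝ) ≤ (J : ℝ) * k := by positivity
  nlinarith

theorem summable_mul_flatWeight {θ ε : ℝ} {p : ℕ → ℝ} (h0 : 0 < θ) (hpi : θ < Real.pi)
    (hε : 0 ≤ ε) (hp : Tendsto (fun k => p k - powLog (fixedExponent θ) k) atTop (𝓝 0))
    (J j : ℕ) : Summable fun k => phaseDensity θ (p k - p j) * flatWeight ε J k := by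
  refine Summable.of_nonneg_of_le
    (fun k => mul_nonneg (phaseDensity_pos h0 hpi _).le (flatWeight_pos ε J k).le) (fun k => ?_)
    (summable_phaseDensity h0 hpi hp j)
  refine mul_le_of_le_one_right (phaseDensity_pos h0 hpi _).le ?_
  refine Real.rpow_le_one_of_one_le_of_nonpos ?_ (neg_nonpos.2 hε)
  have : (0 : ℝ) ≤ ((max k J : ℕ) : ℝ) := by positivity
  linarith

/-- For j ≥ J the limiting ratio of moments is already below some r1 < 1. For j < J the flat weight
is maximal at j and strictly smaller beyond J, so its average is strictly smaller too; finitely many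
such j allow one common r. -/
theorem exists_flatWeight_contraction {θ ε : ℝ} {p : ℕ → ℝ} (h0 : 0 < θ) (hpi : θ < Real.pi)
    (hε : 0 < ε) (hε' : ε < 2)
    (hp : Tendsto (fun k => p k - powLog (fixedExponent θ) k) atTop (𝓝 0)) :
    ∃ r J, 0 < r ∧ r < 1 ∧ ∀ j, ∑' k, phaseDensity θ (p k - p j) * flatWeight ε J k
      ≤ r * (flatWeight ε J j * ∑' k, phaseDensity θ (p k - p j)) := by
  have ha := one_lt_fixedExponent h0
  have hI0 := densityMoment_pos h0 hpi
  have hlt : densityMoment θ ε / densityMoment θ 0 < 1 :=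
    (div_lt_one hI0).2 (densityMoment_lt h0 hpi hε hε')
  obtain ⟨r1, hr1, hr1'⟩ := exists_between hlt
  obtain ⟨J, hJ⟩ := eventually_atTop.1
    ((tendsto_ratio h0 hpi hε.le (by linarith) hp).eventually (gt_mem_nhds hr1))
  have hB := tsum_phaseDensity_pos h0 hpi hp
  have hsB := summable_phaseDensity h0 hpi hp
  have hsW := summable_mul_flatWeight h0 hpi hε.le hp J
  have hdpos : ∀ t, 0 < phaseDensity θ t := phaseDensity_pos h0 hpi
  have hsmall : ∀ᶠ r in 𝓝[<] (1 : ℝ), ∀ j ∈ Finset.range J,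
      ∑' k, phaseDensity θ (p k - p j) * flatWeight ε J k
        ≤ r * (flatWeight ε J j * ∑' k, phaseDensity θ (p k - p j)) := by
    rw [Filter.eventually_all_finset]
    intro j hj
    have hjJ : j ≤ J := (Finset.mem_range.1 hj).le
    have hle : ∀ k, flatWeight ε J k ≤ flatWeight ε J j := by
      intro k
      have : ((max j J : ℕ) : ℝ) ≤ (max k J : ℕ) := by
        exact_mod_cast max_le (hjJ.trans (le_max_right k J)) (le_max_right k J)
      exact Real.rpow_le_rpow_of_nonpos (by positivity) (by linarith) (by linarith)
    have hlt' : flatWeight ε J (J + 1) < flatWeight ε J j := by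
      rw [flatWeight, flatWeight, max_eq_right hjJ, max_eq_left (Nat.le_succ J)]
      refine Real.rpow_lt_rpow_of_neg (by positivity) ?_ (by linarith)
      push_cast
      linarith
    have hstrict : ∑' k, phaseDensity θ (p k - p j) * flatWeight ε J k
        < 1 * (flatWeight ε J j * ∑' k, phaseDensity θ (p k - p j)) := by
      rw [one_mul, mul_comm, ← tsum_mul_right]
      exact (hsW j).tsum_lt_tsum (fun k => mul_le_mul_of_nonneg_left (hle k) (hdpos _).le)
        (mul_lt_mul_of_pos_left hlt' (hdpos _)) ((hsB j).mul_right _)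
    have hcont : Tendsto (fun r : ℝ => r * (flatWeight ε J j * ∑' k, phaseDensity θ (p k - p j)))
        (𝓝[<] 1) (𝓝 (1 * (flatWeight ε J j * ∑' k, phaseDensity θ (p k - p j)))) :=
      (Continuous.tendsto (by fun_prop) _).mono_left nhdsWithin_le_nhds
    filter_upwards [hcont.eventually (lt_mem_nhds hstrict)] with r hr using hr.le
  obtain ⟨r, hr2, hr3⟩ := (hsmall.and
    (Ioo_mem_nhdsLT (max_lt hr1' one_pos) : ∀ᶠ r in 𝓝[<] (1 : ℝ), r ∈ Set.Ioo (max r1 0) 1)).exists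
  have hr0 : 0 < r := (le_max_right r1 0).trans_lt hr3.1
  have hr1r : r1 ≤ r := (le_max_left r1 0).trans hr3.1.le
  refine ⟨r, J, hr0, hr3.2, fun j => ?_⟩
  rcases lt_or_ge j J with hj | hj
  · exact hr2 j (Finset.mem_range.2 hj)
  · have h1 := (hJ j hj).le
    rw [div_le_iff₀ (mul_pos (rpow_weight_pos _ j) (hB j))] at h1
    have hw : flatWeight ε J j = ((j : ℝ) + 1) ^ (-ε) := by rw [flatWeight, max_eq_left hj]
    have h2 : ∑' k, phaseDensity θ (p k - p j) * flatWeight ε J k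
        ≤ ∑' k : ℕ, phaseDensity θ (p k - p j) * ((k : ℝ) + 1) ^ (-ε) :=
      (hsW j).tsum_le_tsum
        (fun k => mul_le_mul_of_nonneg_left (flatWeight_le hε.le J k) (hdpos _).le)
        ((tendsto_riemannSum h0 hpi hε.le (by linarith) hp).1 j)
    rw [hw]
    refine h2.trans (h1.trans (mul_le_mul_of_nonneg_right hr1r ?_))
    exact (mul_pos (rpow_weight_pos _ j) (hB j)).le

/-! ### Perturbations of the fixed point: averages, decay and contraction -/

theorem exists_phase_sub_eq {θ : ℝ} (h0 : 0 < θ) (hpi : θ < Real.pi) (s t : ℝ) :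
    ∃ ξ, |ξ - t| ≤ |s - t| ∧ phase θ s - phase θ t = -(phaseDensity θ ξ * (s - t)) := by
  have hc : ∀ S : Set ℝ, ContinuousOn (phase θ) S := fun S =>
    (phase_continuous h0 hpi).continuousOn
  rcases lt_trichotomy s t with h | h | h
  · obtain ⟨ξ, hξ, he⟩ := exists_hasDerivAt_eq_slope (phase θ) _ h (hc (Set.Icc s t))
      fun x _ => phase_hasDerivAt h0 hpi x
    refine ⟨ξ, ?_, ?_⟩
    · rw [abs_of_neg (by linarith [hξ.2]), abs_of_neg (by linarith)]; linarith [hξ.1]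
    · rw [eq_div_iff (by linarith)] at he
      linarith
  · exact ⟨t, by simp, by simp [h]⟩
  · obtain ⟨ξ, hξ, he⟩ := exists_hasDerivAt_eq_slope (phase θ) _ h (hc (Set.Icc t s))
      fun x _ => phase_hasDerivAt h0 hpi x
    refine ⟨ξ, ?_, ?_⟩
    · rw [abs_of_pos (by linarith [hξ.1]), abs_of_pos (by linarith)]; linarith [hξ.2]
    · rw [eq_div_iff (by linarith)] at he
      linarith

/-- The image of a perturbation is controlled by weighted averages of the perturbation. -/
theorem LogImage.abs_sub_mul_tsum_le {θ : ℝ} (h0 : 0 < θ) (hpi : θ < Real.pi) {Q x y p w : ℕ → ℝ}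
    (hx : LogImage θ Q x y) (hp : LogImage θ Q p p) {D E : ℝ} (hD : ∀ k, |x k - p k| ≤ D)
    (hE : ∀ s t, |s - t| ≤ 2 * D → phaseDensity θ s ≤ E * phaseDensity θ t)
    (hw : ∀ k, |x k - p k| ≤ w k) {j : ℕ} (hs : Summable fun k => phaseDensity θ (p k - p j))
    (hsw : Summable fun k => phaseDensity θ (p k - p j) * w k) :
    |y j - p j| * ∑' k, phaseDensity θ (p k - p j)
      ≤ E ^ 2 * ∑' k, phaseDensity θ (p k - p j) * w k := by
  have hd := phaseDensity_pos h0 hpi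
  have hD0 : 0 ≤ D := (abs_nonneg _).trans (hD 0)
  have hE0 : 0 < E := by
    have h := hE 0 0 (by simpa using hD0)
    exact pos_of_mul_pos_left ((hd 0).trans_le h) (hd 0).le
  set u := y j - p j with hu_def
  have hu : |u| ≤ D := hx.abs_sub_le h0 hpi hp hD j
  choose ξ hξ hphase using fun k => exists_phase_sub_eq h0 hpi (x k - y j) (p k - p j)
  have hdist : ∀ k, |ξ k - (p k - p j)| ≤ 2 * D := fun k => by
    refine (hξ k).trans ?_
    rw [show x k - y j - (p k - p j) = (x k - p k) - u by rw [hu_def]; ring]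
    exact (abs_sub _ _).trans (by linarith [hD k])
  have hup : ∀ k, phaseDensity θ (ξ k) ≤ E * phaseDensity θ (p k - p j) := fun k =>
    hE _ _ (hdist k)
  have hlo : ∀ k, phaseDensity θ (p k - p j) ≤ E * phaseDensity θ (ξ k) := fun k =>
    hE _ _ (by rw [abs_sub_comm]; exact hdist k)
  have sω : Summable fun k => phaseDensity θ (ξ k) :=
    Summable.of_nonneg_of_le (fun k => (hd _).le) hup (hs.mul_left E)
  have habs : ∀ k, |phaseDensity θ (ξ k) * (x k - p k)|
      ≤ E * (phaseDensity θ (p k - p j) * w k) := fun k => by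
    rw [abs_mul, abs_of_pos (hd _), ← mul_assoc]
    exact mul_le_mul (hup k) (hw k) (abs_nonneg _) (mul_pos hE0 (hd _)).le
  have sv : Summable fun k => phaseDensity θ (ξ k) * (x k - p k) :=
    Summable.of_norm_bounded (hsw.mul_left E) habs
  -- The equations for x and p have the same right side. Subtracting them shows that u is exactly
  -- the average of x_k - p_k with weights `phaseDensity θ (ξ k)`. Replacing these weights by those
  -- at p costs a factor E in the numerator and another in the denominator.
  have hzero : HasSum (fun k => phaseDensity θ (ξ k) * (x k - p k) - phaseDensity θ (ξ k) * u)
      0 := by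
    have h := ((hx j).sub (hp j)).neg
    rw [sub_self, neg_zero] at h
    refine h.congr_fun fun k => ?_
    rw [hphase k, hu_def]
    ring
  have heq : ∑' k, phaseDensity θ (ξ k) * (x k - p k) = (∑' k, phaseDensity θ (ξ k)) * u := by
    have h := hzero.tsum_eq
    rw [sv.tsum_sub (sω.mul_right u), tsum_mul_right] at h
    linarith
  have h1 : |u| * ∑' k, phaseDensity θ (ξ k)
      ≤ E * ∑' k, phaseDensity θ (p k - p j) * w k := by
    have hpos : 0 ≤ ∑' k, phaseDensity θ (ξ k) := tsum_nonneg fun k => (hd _).le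
    rw [← abs_of_nonneg hpos, ← abs_mul, mul_comm u, ← heq, ← tsum_mul_left]
    exact tsum_of_norm_bounded (f := fun k => phaseDensity θ (ξ k) * (x k - p k))
      (hsw.mul_left E).hasSum habs
  have h2 : ∑' k, phaseDensity θ (p k - p j) ≤ E * ∑' k, phaseDensity θ (ξ k) := by
    rw [← tsum_mul_left]
    exact hs.tsum_le_tsum hlo (sω.mul_left E)
  calc _ ≤ |u| * (E * ∑' k, phaseDensity θ (ξ k)) := by gcongr
    _ = E * (|u| * ∑' k, phaseDensity θ (ξ k)) := by ring
    _ ≤ E * (E * ∑' k, phaseDensity θ (p k - p j) * w k) := by gcongr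
    _ = _ := by ring

theorem BddDist.of_close {x p : ℕ → ℝ} {a D : ℝ}
    (hp : Tendsto (fun k => p k - powLog a k) atTop (𝓝 0)) (h : ∀ k, |x k - p k| ≤ D) :
    BddDist x (powLog a) :=
  BddDist.trans ⟨D, h⟩ (bddDist_of_tendsto hp)

/-- The operator preserves the decay rate of the distance to the fixed point. -/
theorem Admissible.exists_decay {θ ε : ℝ} {Q x p : ℕ → ℝ} (A : Admissible θ Q)
    (hp : LogImage θ Q p p)
    (hp0 : Tendsto (fun k => p k - powLog (fixedExponent θ) k) atTop (𝓝 0))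
    (hε : 0 ≤ ε) (hε' : ε < fixedExponent θ + 1) {C : ℝ} (hC : 0 < C)
    (hx : ∀ k : ℕ, |x k - p k| ≤ C * ((k : ℝ) + 1) ^ (-ε)) :
    ∃ C', 0 < C' ∧ ∀ k : ℕ, |logT θ Q x k - p k| ≤ C' * ((k : ℝ) + 1) ^ (-ε) := by
  have h0 := A.pos
  have hpi := A.lt_pi
  have hD : ∀ k, |x k - p k| ≤ C := fun k => by
    refine (hx k).trans (mul_le_of_le_one_right hC.le ?_)
    refine Real.rpow_le_one_of_one_le_of_nonpos ?_ (neg_nonpos.2 hε)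
    have : (0 : ℝ) ≤ k := by positivity
    linarith
  obtain ⟨c, hc, hcE⟩ := exists_phaseDensity_mul_le h0 hpi
  obtain ⟨C1, hC1, hav⟩ := exists_average_le h0 hpi hε hε' hp0
  set E := 1 + c * (Real.exp (2 * C) - 1)
  have hE0 : 0 < E := by
    have : 0 ≤ Real.exp (2 * C) - 1 := by linarith [Real.add_one_le_exp (2 * C)]
    positivity
  refine ⟨E ^ 2 * C * C1, by positivity, fun j => ?_⟩
  have hB := tsum_phaseDensity_pos h0 hpi hp0 j
  have hsA := (tendsto_riemannSum h0 hpi hε hε' hp0).1 j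
  have h := (A.logImage (BddDist.of_close hp0 hD)).abs_sub_mul_tsum_le h0 hpi hp hD
    (fun s t => hcE s t (2 * C)) hx (summable_phaseDensity h0 hpi hp0 j)
    ((hsA.mul_left C).congr fun k => by ring)
  refine le_of_mul_le_mul_right (h.trans ?_) hB
  have e : ∑' k : ℕ, phaseDensity θ (p k - p j) * (C * ((k : ℝ) + 1) ^ (-ε))
      = C * ∑' k : ℕ, phaseDensity θ (p k - p j) * ((k : ℝ) + 1) ^ (-ε) := by
    rw [← tsum_mul_left]
    exact tsum_congr fun k => by ring
  rw [e]
  calc _ = E ^ 2 * C * ∑' k : ℕ, phaseDensity θ (p k - p j) * ((k : ℝ) + 1) ^ (-ε) := by ring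
    _ ≤ E ^ 2 * C * (C1 * (((j : ℝ) + 1) ^ (-ε) * ∑' k : ℕ, phaseDensity θ (p k - p j))) := by
      gcongr
      exact hav j
    _ = _ := by ring

/-- Near the fixed point, the operator contracts a weighted norm. -/
theorem Admissible.exists_local_contraction {θ ε : ℝ} {Q p : ℕ → ℝ} (A : Admissible θ Q)
    (hp : LogImage θ Q p p)
    (hp0 : Tendsto (fun k => p k - powLog (fixedExponent θ) k) atTop (𝓝 0))
    (hε : 0 < ε) (hε' : ε < 2) :
    ∃ r δ J, 0 < r ∧ r < 1 ∧ 0 < δ ∧ ∀ x s, (∀ k, |x k - p k| ≤ δ) →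
      (∀ k, |x k - p k| ≤ s * flatWeight ε J k) →
      ∀ k, |logT θ Q x k - p k| ≤ r * s * flatWeight ε J k := by
  have h0 := A.pos
  have hpi := A.lt_pi
  obtain ⟨r0, J, hr0, hr0', hcon⟩ := exists_flatWeight_contraction h0 hpi hε hε' hp0
  obtain ⟨c, hc, hcE⟩ := exists_phaseDensity_mul_le h0 hpi
  -- The distortion E² tends to 1 as δ tends to 0, so it cannot spoil the linear contraction factor
  -- r0.
  obtain ⟨δ, hδ, hδr⟩ : ∃ δ : ℝ, 0 < δ ∧ (1 + c * (Real.exp (2 * δ) - 1)) ^ 2 * r0 < 1 := by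
    have hlim : Tendsto (fun δ : ℝ => (1 + c * (Real.exp (2 * δ) - 1)) ^ 2 * r0) (𝓝[>] 0)
        (𝓝 ((1 + c * (Real.exp (2 * 0) - 1)) ^ 2 * r0)) :=
      (Continuous.tendsto (by fun_prop) _).mono_left nhdsWithin_le_nhds
    have hlt : (1 + c * (Real.exp (2 * 0) - 1)) ^ 2 * r0 < 1 := by simpa using hr0'
    obtain ⟨δ, h1, h2⟩ := ((hlim.eventually (gt_mem_nhds hlt)).and
      self_mem_nhdsWithin).exists
    exact ⟨δ, h2, h1⟩
  set E := 1 + c * (Real.exp (2 * δ) - 1)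
  have hE0 : 0 < E := by
    have : 0 ≤ Real.exp (2 * δ) - 1 := by linarith [Real.add_one_le_exp (2 * δ)]
    positivity
  refine ⟨E ^ 2 * r0, δ, J, by positivity, hδr, hδ, fun x s hx hxs j => ?_⟩
  have hs0 : 0 ≤ s :=
    nonneg_of_mul_nonneg_left ((abs_nonneg _).trans (hxs 0)) (flatWeight_pos ε J 0)
  have hsW := summable_mul_flatWeight h0 hpi hε.le hp0 J j
  have hB := tsum_phaseDensity_pos h0 hpi hp0 j
  have h := (A.logImage (BddDist.of_close hp0 hx)).abs_sub_mul_tsum_le h0 hpi hp hx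
    (fun s t => hcE s t (2 * δ)) hxs (summable_phaseDensity h0 hpi hp0 j)
    ((hsW.mul_left s).congr fun k => by ring)
  refine le_of_mul_le_mul_right (h.trans ?_) hB
  have e : ∑' k, phaseDensity θ (p k - p j) * (s * flatWeight ε J k)
      = s * ∑' k, phaseDensity θ (p k - p j) * flatWeight ε J k := by
    rw [← tsum_mul_left]
    exact tsum_congr fun k => by ring
  rw [e]
  calc _ ≤ E ^ 2 * (s * (r0 * (flatWeight ε J j * ∑' k, phaseDensity θ (p k - p j)))) := by
        gcongr
        exact hcon j
    _ = _ := by ring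

theorem Admissible.exists_iterate_decay {θ ε : ℝ} {Q x p : ℕ → ℝ} (A : Admissible θ Q)
    (hp : LogImage θ Q p p)
    (hp0 : Tendsto (fun k => p k - powLog (fixedExponent θ) k) atTop (𝓝 0))
    (hε : 0 ≤ ε) (hε' : ε < fixedExponent θ + 1) {C : ℝ} (hC : 0 < C)
    (hx : ∀ k : ℕ, |x k - p k| ≤ C * ((k : ℝ) + 1) ^ (-ε)) (n : ℕ) :
    ∃ C', 0 < C' ∧ ∀ k : ℕ, |(logT θ Q)^[n] x k - p k| ≤ C' * ((k : ℝ) + 1) ^ (-ε) := by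
  induction n with
  | zero => exact ⟨C, hC, hx⟩
  | succ n ih =>
    obtain ⟨C', hC', h⟩ := ih
    rw [Function.iterate_succ_apply']
    exact A.exists_decay hp hp0 hε hε' hC' h

/-- Global exponential attraction. -/
theorem Admissible.exists_exponential_rate {θ ε : ℝ} {Q p : ℕ → ℝ} (A : Admissible θ Q)
    (hp : LogImage θ Q p p)
    (hp0 : Tendsto (fun k => p k - powLog (fixedExponent θ) k) atTop (𝓝 0))
    (hε : 0 < ε) (hε' : ε < 2) :
    ∃ r, 0 < r ∧ r < 1 ∧ ∀ R : ℝ, 0 ≤ R → ∃ C, 0 < C ∧ ∀ x : ℕ → ℝ,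
      (∀ k : ℕ, |x k - p k| ≤ R * ((k : ℝ) + 1) ^ (-ε)) →
      ∀ n k : ℕ, |(logT θ Q)^[n] x k - p k| ≤ C * r ^ n * ((k : ℝ) + 1) ^ (-ε) := by
  have ha := one_lt_fixedExponent A.pos
  obtain ⟨r, δ, J, hr0, hr1, hδ, hcon⟩ := A.exists_local_contraction hp hp0 hε hε'
  refine ⟨r, hr0, hr1, fun R hR => ?_⟩
  have hR1 : 0 < R + 1 := by linarith
  -- By monotonicity, the orbits of these two sequences enclose the orbit of every x in the ball, so
  -- constants found for them depend on R only. The radius R + 1 stays positive when R = 0.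
  set h : ℕ → ℝ := fun k => p k + (R + 1) * ((k : ℝ) + 1) ^ (-ε) with hh
  set l : ℕ → ℝ := fun k => p k - (R + 1) * ((k : ℝ) + 1) ^ (-ε) with hl
  have hwpos := rpow_weight_pos (-ε)
  have hhp : ∀ k : ℕ, |h k - p k| ≤ (R + 1) * ((k : ℝ) + 1) ^ (-ε) := fun k => by
    rw [hh, add_sub_cancel_left, abs_of_pos (mul_pos hR1 (hwpos k))]
  have hlp : ∀ k : ℕ, |l k - p k| ≤ (R + 1) * ((k : ℝ) + 1) ^ (-ε) := fun k => by
    rw [hl, sub_sub_cancel_left, abs_neg, abs_of_pos (mul_pos hR1 (hwpos k))]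
  have hlim : ∀ x : ℕ → ℝ, (∀ k : ℕ, |x k - p k| ≤ (R + 1) * ((k : ℝ) + 1) ^ (-ε)) →
      Tendsto (fun k => x k - powLog (fixedExponent θ) k) atTop (𝓝 0) := fun x hx => by
    have := (tendsto_zero_of_le_rpow_weight hε hx).add hp0
    simpa using this
  obtain ⟨n0, hn0⟩ := eventually_atTop.1
    ((A.eventually_iterate_close hp hp0 (hlim h hhp) hδ).and
      (A.eventually_iterate_close hp hp0 (hlim l hlp) hδ))
  choose Ch hCh hdh using A.exists_iterate_decay hp hp0 hε.le (by linarith) hR1 hhp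
  choose Cl hCl hdl using A.exists_iterate_decay hp hp0 hε.le (by linarith) hR1 hlp
  have hJ := rpow_weight_pos ε J
  -- This bounds the flattened norm at time n0; (J + 1)^ε converts from the weight k^{-ε} to the
  -- flat one.
  set B := (Ch n0 + Cl n0) * ((J : ℝ) + 1) ^ ε with hB
  have hB0 : 0 < B := mul_pos (add_pos (hCh _) (hCl _)) hJ
  have hsum0 : ∀ n, 0 ≤ (Ch n + Cl n) / r ^ n := fun n =>
    (div_pos (add_pos (hCh n) (hCl n)) (pow_pos hr0 n)).le
  have hS0 : 0 ≤ ∑ n ∈ Finset.range n0, (Ch n + Cl n) / r ^ n :=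
    Finset.sum_nonneg fun n _ => hsum0 n
  -- The sum covers the finitely many steps before the contraction starts, and B / r^n0 covers all
  -- later ones.
  refine ⟨B / r ^ n0 + ∑ n ∈ Finset.range n0, (Ch n + Cl n) / r ^ n,
    add_pos_of_pos_of_nonneg (div_pos hB0 (pow_pos hr0 _)) hS0, fun x hx => ?_⟩
  have bh := bddDist_of_tendsto (hlim h hhp)
  have bl := bddDist_of_tendsto (hlim l hlp)
  have hx' : ∀ k : ℕ, |x k - p k| ≤ (R + 1) * ((k : ℝ) + 1) ^ (-ε) := fun k =>
    (hx k).trans (mul_le_mul_of_nonneg_right (by linarith) (hwpos k).le)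
  have bx := bddDist_of_tendsto (hlim x hx')
  have hxh := A.iterate_mono bx bh fun k => by
    simp only [hh]; linarith [(abs_le.1 (hx' k)).2]
  have hlx := A.iterate_mono bl bx fun k => by
    simp only [hl]; linarith [(abs_le.1 (hx' k)).1]
  have hfirst : ∀ n k : ℕ, |(logT θ Q)^[n] x k - p k|
      ≤ (Ch n + Cl n) * ((k : ℝ) + 1) ^ (-ε) := fun n k => by
    have e1 := (abs_le.1 (hdh n k)).2
    have e2 := (abs_le.1 (hdl n k)).1
    have e3 := mul_pos (hCh n) (hwpos k)
    have e4 := mul_pos (hCl n) (hwpos k)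
    rw [abs_le, add_mul]
    constructor <;> linarith [hxh n k, hlx n k]
  have hclose : ∀ n, n0 ≤ n → ∀ k, |(logT θ Q)^[n] x k - p k| ≤ δ := fun n hn k => by
    have e1 := (abs_le.1 ((hn0 n hn).1 k)).2
    have e2 := (abs_le.1 ((hn0 n hn).2 k)).1
    rw [abs_le]
    constructor <;> linarith [hxh n k, hlx n k]
  have hlater : ∀ m k : ℕ, |(logT θ Q)^[n0 + m] x k - p k| ≤ B * r ^ m * flatWeight ε J k := by
    intro m
    induction m with
    | zero =>
      intro k
      rw [pow_zero, mul_one, hB, mul_assoc]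
      exact (hfirst n0 k).trans (mul_le_mul_of_nonneg_left (le_mul_flatWeight hε.le J k)
        (add_pos (hCh _) (hCl _)).le)
    | succ m ih =>
      intro k
      have e := hcon _ (B * r ^ m) (hclose (n0 + m) (Nat.le_add_right _ _)) ih k
      rw [← add_assoc, Function.iterate_succ_apply']
      refine e.trans_eq ?_
      ring
  intro n k
  rcases lt_or_ge n n0 with hn | hn
  · refine (hfirst n k).trans (mul_le_mul_of_nonneg_right ?_ (hwpos k).le)
    rw [← div_le_iff₀ (pow_pos hr0 n)]
    have := Finset.single_le_sum (f := fun n => (Ch n + Cl n) / r ^ n) (fun i _ => hsum0 i)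
      (Finset.mem_range.2 hn)
    linarith [div_pos hB0 (pow_pos hr0 n0)]
  · obtain ⟨m, rfl⟩ := Nat.exists_eq_add_of_le hn
    refine (hlater m k).trans ?_
    refine mul_le_mul ?_ (flatWeight_le hε.le J k) (flatWeight_pos ε J k).le (by positivity)
    calc B * r ^ m = B / r ^ n0 * r ^ (n0 + m) := by
          rw [pow_add]; field_simp
      _ ≤ _ := by gcongr; linarith

/-! ### Return to positive sequences -/

theorem Admissible.iterate_T {θ : ℝ} {Q X : ℕ → ℝ} (A : Admissible θ Q) (hX : ∀ k, 0 < X k)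
    (hx : BddDist (logSeq X) (powLog (fixedExponent θ))) (n : ℕ) :
    (∀ k, 0 < (T θ Q)^[n] X k) ∧ logSeq ((T θ Q)^[n] X) = (logT θ Q)^[n] (logSeq X) := by
  induction n with
  | zero => exact ⟨hX, rfl⟩
  | succ n ih =>
    have hb : BddDist (logSeq ((T θ Q)^[n] X)) (powLog (fixedExponent θ)) := by
      rw [ih.2]; exact A.bddDist_iterate hx n
    rw [Function.iterate_succ_apply', Function.iterate_succ_apply',
      ((A.logImage hb).T_eq A.pos A.lt_pi ih.1).2, logSeq_exp, ih.2]
    exact ⟨fun k => Real.exp_pos _, rfl⟩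

theorem wnorm_le_ofReal_iff {ε C : ℝ} (hC : 0 ≤ C) {v : ℕ → ℝ} :
    wnorm ε v ≤ ENNReal.ofReal C ↔ ∀ k : ℕ, |v k| ≤ C * ((k : ℝ) + 1) ^ (-ε) := by
  rw [wnorm, iSup_le_iff]
  refine forall_congr' fun k => ?_
  have hk : (0 : ℝ) < (k : ℝ) + 1 := by positivity
  rw [ENNReal.ofReal_le_ofReal_iff hC, Real.rpow_neg hk.le, ← div_eq_mul_inv,
    le_div_iff₀ (rpow_weight_pos ε k), mul_comm]

theorem Admissible.invariant_powU0 {θ : ℝ} {Q : ℕ → ℝ} (A : Admissible θ Q) :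
    Invariant θ Q (powU0 (fixedExponent θ) 0) := by
  rintro X ⟨hX, hx⟩
  have hx' := mem_smallU0_zero_iff.1 hx
  have h := (A.logImage (bddDist_of_tendsto hx')).T_eq A.pos A.lt_pi hX
  refine ⟨h.1, ?_⟩
  rw [h.2]
  refine ⟨fun k => Real.exp_pos _, ?_⟩
  rw [logSeq_exp, mem_smallU0_zero_iff]
  exact A.tendsto_logT_sub hx'

theorem Admissible.invariant_seqU {θ ε : ℝ} {Q p : ℕ → ℝ} (A : Admissible θ Q)
    (hp : LogImage θ Q p p)
    (hp0 : Tendsto (fun k => p k - powLog (fixedExponent θ) k) atTop (𝓝 0))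
    (hε : 0 ≤ ε) (hε' : ε < fixedExponent θ + 1) :
    Invariant θ Q (seqU (fun k => Real.exp (p k)) ε) := by
  rintro X ⟨hX, hx⟩
  rw [logSeq_exp, mem_smallU_iff] at hx
  obtain ⟨C, hC, hx⟩ := hx
  have hb : BddDist (logSeq X) (powLog (fixedExponent θ)) := by
    refine BddDist.of_close hp0 (D := C) fun k => (hx k).trans (mul_le_of_le_one_right hC.le ?_)
    refine Real.rpow_le_one_of_one_le_of_nonpos ?_ (neg_nonpos.2 hε)
    have : (0 : ℝ) ≤ k := by positivity
    linarith
  have h := (A.logImage hb).T_eq A.pos A.lt_pi hX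
  refine ⟨h.1, ?_⟩
  rw [h.2]
  refine ⟨fun k => Real.exp_pos _, ?_⟩
  rw [logSeq_exp, logSeq_exp, mem_smallU_iff]
  exact A.exists_decay hp hp0 hε hε' hC hx

theorem tendsto_sub_atBot_of_exponent_lt {x y : ℕ → ℝ} {a b : ℝ} (hab : a < b)
    (hx : BddDist x (powLog a)) (hy : BddDist y (powLog b)) :
    Tendsto (fun k => x k - y k) atTop atBot := by
  obtain ⟨D, hD⟩ := hx
  obtain ⟨D', hD'⟩ := hy
  have hlog : Tendsto (fun k : ℕ => Real.log ((k : ℝ) + 1)) atTop atTop :=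
    Real.tendsto_log_atTop.comp
      (tendsto_atTop_add_const_right atTop (1 : ℝ) tendsto_natCast_atTop_atTop)
  have h := tendsto_atBot_add_const_right atTop (D + D')
    (hlog.const_mul_atTop_of_neg (sub_neg.2 hab))
  refine tendsto_atBot_mono (fun k => ?_) h
  have e1 := (abs_le.1 (hD k)).2
  have e2 := (abs_le.1 (hD' k)).1
  simp only [powLog] at e1 e2
  linarith

theorem bddDist_of_mem_powU {X : ℕ → ℝ} {β : ℝ} (h : X ∈ powU β 0) :
    BddDist (logSeq X) (powLog β) := by
  obtain ⟨C, -, hC⟩ := mem_smallU_iff.1 h.2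
  refine ⟨C, fun k => ?_⟩
  simpa using hC k

/-- If the exponents differed, the difference of the fixed points, taken in the right order, would
tend to -∞. -/
theorem exponent_unique {θ : ℝ} (h0 : 0 < θ) (hpi : θ < Real.pi) {Q x y : ℕ → ℝ} {a b : ℝ}
    (hx : BddDist x (powLog a)) (hy : BddDist y (powLog b)) (fx : LogImage θ Q x x)
    (fy : LogImage θ Q y y) : a = b := by
  rcases lt_trichotomy a b with h | h | h
  · exact (false_of_tendsto_sub_atBot h0 hpi fx fy
      (tendsto_sub_atBot_of_exponent_lt h hx hy)).elim
  · exact h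
  · exact (false_of_tendsto_sub_atBot h0 hpi fy fx
      (tendsto_sub_atBot_of_exponent_lt h hy hx)).elim

end

end ExactQuantization

theorem mainTheorem2 (θ : ℝ) (hθ0 : 0 < θ) (hθpi : θ < Real.pi) (Q : ℕ → ℝ)
    (hQ : ∃ K : ℝ, ∀ k : ℕ, |Q k - ((k : ℝ) + 1)| ≤ K)
    (hQ' : ∀ k : ℕ, (((k : ℝ) + 1) - 1 / 2) * (θ / Real.pi) < Q k) :
    ∃ α : ℝ, α = 1 + θ / Real.pi ∧
      -- `α` is the unique positive exponent with a fixed point in `U(α, 0)`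
      (0 < α ∧ ∃ X ∈ ExactQuantization.powU α 0, ExactQuantization.IsFixed θ Q X) ∧
      (∀ β : ℝ, 0 < β →
        (∃ X ∈ ExactQuantization.powU β 0, ExactQuantization.IsFixed θ Q X) → β = α) ∧
      -- (1)
      ExactQuantization.Invariant θ Q (ExactQuantization.powU0 α 0) ∧
      -- (2)
      ∃ P ∈ ExactQuantization.powU α 1, ExactQuantization.IsFixed θ Q P ∧
        -- (3)
        (∀ X ∈ ExactQuantization.powU0 α 0,
          Filter.Tendsto (fun n : ℕ => ExactQuantization.wnorm 0
            (ExactQuantization.logSeq ((ExactQuantization.T θ Q)^[n] X)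
              - ExactQuantization.logSeq P)) Filter.atTop (nhds 0)) ∧
        -- (4)
        (∀ ε : ℝ, 0 ≤ ε → ε < α + 1 →
          ExactQuantization.Invariant θ Q (ExactQuantization.seqU P ε)) ∧
        -- (5)
        (∀ ε : ℝ, 0 < ε → ε < 2 →
          ∃ r : ℝ, 0 < r ∧ r < 1 ∧ ∀ R : NNReal, ∃ C : ℝ, 0 < C ∧
            ∀ X ∈ ExactQuantization.seqU P ε,
              ExactQuantization.wnorm ε
                (ExactQuantization.logSeq X - ExactQuantization.logSeq P) ≤ (R : ENNReal) →
              ∀ n : ℕ, ExactQuantization.wnorm ε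
                (ExactQuantization.logSeq ((ExactQuantization.T θ Q)^[n] X)
                  - ExactQuantization.logSeq P) ≤ ENNReal.ofReal (C * r ^ n)) := by
  open ExactQuantization in
  have A : Admissible θ Q := ⟨hθ0, hθpi, hQ, hQ'⟩
  obtain ⟨p, hp, C0, hC0, hpC⟩ := A.exists_fixed
  have hp0 := tendsto_zero_of_le_rpow_weight one_pos hpC
  have hpU : ∀ ε, ε ≤ 1 → (fun k => Real.exp (p k)) ∈ powU (fixedExponent θ) ε := by
    refine fun ε hε => ⟨fun k => Real.exp_pos _, ?_⟩
    rw [logSeq_exp, mem_smallU_iff]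
    refine ⟨C0, hC0, fun k => (hpC k).trans (mul_le_mul_of_nonneg_left ?_ hC0.le)⟩
    refine Real.rpow_le_rpow_of_exponent_le ?_ (by linarith)
    have : (0 : ℝ) ≤ k := by positivity
    linarith
  have hfix := hp.isFixed_exp hθ0 hθpi
  refine ⟨fixedExponent θ, rfl, ⟨fixedExponent_pos hθ0, _, hpU 0 zero_le_one, hfix⟩, ?_,
    A.invariant_powU0, _, hpU 1 le_rfl, hfix, ?_,
    fun ε hε hε' => A.invariant_seqU hp hp0 hε hε', ?_⟩
  · rintro β - ⟨X, hX, hXfix⟩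
    exact exponent_unique hθ0 hθpi (bddDist_of_mem_powU hX) (bddDist_of_tendsto hp0)
      (logImage_of_isFixed hθ0 hθpi hXfix).2 hp
  · rintro X ⟨hX, hx⟩
    have hx' := mem_smallU0_zero_iff.1 hx
    rw [ENNReal.tendsto_nhds_zero]
    intro e he
    -- A finite positive d below e is needed because e may be infinite.
    obtain ⟨d, hd0, hde⟩ := ENNReal.lt_iff_exists_nnreal_btwn.1 he
    have hd0' : (0 : ℝ) < d := by exact_mod_cast hd0
    filter_upwards [A.eventually_iterate_close hp hp0 hx' hd0'] with n hn
    refine le_trans ?_ hde.le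
    rw [← ENNReal.ofReal_coe_nnreal]
    refine (wnorm_le_ofReal_iff d.2).2 fun k => ?_
    rw [logSeq_exp, (A.iterate_T hX (bddDist_of_tendsto hx') n).2]
    simpa using hn k
  · intro ε hε hε'
    obtain ⟨r, hr0, hr1, hrate⟩ := A.exists_exponential_rate hp hp0 hε hε'
    refine ⟨r, hr0, hr1, fun R => ?_⟩
    obtain ⟨C, hC, h⟩ := hrate R R.2
    refine ⟨C, hC, fun X hX hXR n => ?_⟩
    rw [← ENNReal.ofReal_coe_nnreal, logSeq_exp] at hXR
    have hXR' := (wnorm_le_ofReal_iff R.2).1 hXR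
    have hx' : Filter.Tendsto (fun k => logSeq X k - powLog (fixedExponent θ) k) Filter.atTop
        (nhds 0) := by
      have := (tendsto_zero_of_le_rpow_weight hε hXR').add hp0
      simpa using this
    refine (wnorm_le_ofReal_iff (by positivity)).2 ?_
    rw [logSeq_exp, (A.iterate_T hX.1 (bddDist_of_tendsto hx') n).2]
    exact h _ hXR' n
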